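/- Let $n\ge 2$, identify $\mathbb R^2=\mathbb C$, put $w=e^{i\pi/n}$, and let $\mathcal D_n=\{r^j,\ r^j\sigma : 0\le j<n\}$ be the dihedral group of order $2n$, where $r(z)=w^2z$ and $\sigma(z)=\overline z$, with positive roots $R_+=\{iw^j : 0\le j<n\}$. Let $k\in\mathbb C$, $\gamma:=nk$, and assume $\gamma\notin\{-m/2 : m=0,1,2,\dots\}$. For $\xi\in\mathbb R^2$ let $$T_\xi f(x)=\partial_\xi f(x)+k\sum_{\alpha\in R_+}\langle\alpha,\xi\rangle\frac{f(x)-f(\sigma_\alpha x)}{\langle\alpha,x\rangle},\qquad \sigma_\alpha x=x-2\frac{\langle x,\alpha\rangle}{|\alpha|^2}\alpha ,$$ be the Dunkl operators on $\mathbb C[\mathbb R^2]$. Then there is a unique linear automorphism $V_k$ of $\mathbb C[\mathbb R^2]$ that maps homogeneous polynomials of degree $m$ to homogeneous polynomials of degree $m$ for every $m$, and satisfies $V_k(1)=1$ and $T_\xi V_k=V_k\partial_\xi$ for all $\xi$. Put $E_m(x,y)=\frac1{m!}V_k(\langle\cdot,y\rangle^m)(x)$. For $x,y\in\mathbb R^2$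 let $a(x,y)=\max_{g\in\mathcal D_n}|\langle gx,y\rangle|$ and $$g(z),\,g_s(z)=\sum_{i=0}^{n-1}\frac{\langle r^ix,y\rangle}{1-z\langle r^ix,y\rangle}\pm\sum_{i=0}^{n-1}\frac{\langle r^i\sigma x,y\rangle}{1-z\langle r^i\sigma x,y\rangle}$$ (with $+$ for $g$ and $-$ for $g_s$), and consider the group differential system $$X'(z)=\begin{bmatrix}g(z)\\ g_s(z)\end{bmatrix}+\begin{bmatrix}\frac{\gamma}{2n}g(z)&-\frac{\gamma}{2n}g_s(z)\\ \frac{\gamma}{2n}g_s(z)&-\left(\frac{2\gamma}{z}+\frac{\gamma}{2n}g(z)\right)\end{bmatrix}X(z).$$ Let $Q(z)=Q(z,x,y)=\sum_{p\ge1}A_pz^p\in\mathbb C^2$, where $A_0=(\frac{2n}{\gamma},0)$, and, for $p\ge1$ and $q\ge 0$ respectively, $$A_p=\begin{bmatrix}\frac1p&0\\0&\frac1{p+2\gamma}\end{bmatrix}\sum_{i=0}^{p-1}B_{p-i-1}A_i,\qquad B_q=\frac{\gamma}{2n}\sum_{i=0}^{n-1}\begin{bmatrix}u_i+v_i&-(u_i-v_i)\\u_i-v_i&-(u_i+v_i)\end{bmatrix},$$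 with $u_i=\langle r^ix,y\rangle^{q+1}$ and $v_i=\langle r^i\sigma x,y\rangle^{q+1}$. Put $\Phi(z,x,y)=\frac{2n}{\gamma}+Q_1(z,x,y)-Q_2(z,x,y)$. There is a constant $\delta\ge1$, depending only on $n$ and $k$, such that for all $x,y\in\mathbb R^2$, with $\mathbb D$ the open disc of centre $0$ and radius $\frac1{\delta a(x,y)}$ ($\mathbb D=\mathbb C$ if $a(x,y)=0$): 1. The series $Q$ converges on $\mathbb D$, is holomorphic there, vanishes at $0$ and solves the group differential system on $\mathbb D\setminus\{0\}$. Every $\mathbb C^2$-valued holomorphic function on a disc $\{|z|<r\}$, $r>0$, that vanishes at $0$ and solves the system on $\{0<|z|<r\}$ coincides with $Q$ on $\{|z|<r\}\cap\mathbb D$. 2. For all $0<\rho<\frac1{\delta a(x,y)}$ (any $\rho>0$ if $a(x,y)=0$) and all integers $m\ge0$, $$E_m(x,y)=\frac{\gamma/2n}{(1+\gamma)_m}\,\frac1{2i\pi}\int_{|z|=\rho}\frac{\Phi(z,x,y)}{1-z\langle x,y\rangle}\,\frac{dz}{z^{m+1}},$$ where $(c)_m=c(c+1)\cdots(c+m-1)$.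 3. For all $z\in\mathbb D$, $$\frac{\Phi(z,x,y)}{1-z\langle x,y\rangle}=\frac{2n}{\gamma}\sum_{m=0}^{\infty}(1+\gamma)_m\,E_m(x,y)\,z^m,$$ with convergence of the series. -/

import Mathlib

namespace DihedralDunkl

noncomputable section

open MvPolynomial

/-- The Euclidean plane `ℝ²`. -/
abbrev Plane : Type := EuclideanSpace ℝ (Fin 2)

/-- The algebra `ℂ[ℝ²]` of complex polynomials on the plane. -/
abbrev Poly : Type := MvPolynomial (Fin 2) ℂ

/-! ### The dihedral group of order `2 n` acting on the plane -/

/-- The rotation `r ^ j`, where `r` is the rotation by the angle `2 π / n`. -/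
def rot (n j : ℕ) (x : Plane) : Plane :=
  !₂[Real.cos (2 * Real.pi * j / n) * x 0 - Real.sin (2 * Real.pi * j / n) * x 1,
    Real.sin (2 * Real.pi * j / n) * x 0 + Real.cos (2 * Real.pi * j / n) * x 1]

/-- The reflection `σ`, which is complex conjugation under `ℝ² = ℂ`. -/
def sigma (x : Plane) : Plane := !₂[x 0, -x 1]

/-- The positive roots `i w ^ j`, `w = exp (i π / n)`, `0 ≤ j < n`, under `ℝ² = ℂ`. -/
def root (n j : ℕ) : Plane :=
  !₂[-Real.sin (Real.pi * j / n), Real.cos (Real.pi * j / n)]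

/-- `a(x, y)`, the maximum of `|⟨g x, y⟩|` over the `2 n` elements `g = r ^ j`, `g = r ^ j σ`
of the dihedral group. -/
def maxPairing (n : ℕ) (x y : Plane) : ℝ :=
  ⨆ j : Fin n, max |inner ℝ (rot n j x) y| |inner ℝ (rot n j (sigma x)) y|

/-! ### Dunkl operators and the intertwining operator on polynomials -/

/-- The linear form `⟨·, y⟩` as a polynomial. -/
def linForm (y : Plane) : Poly := ∑ i, C (y i : ℂ) * X i

/-- The value of a polynomial at a point of the real plane. -/
def evalAt (x : Plane) (p : Poly) : ℂ := eval (fun i => (x i : ℂ)) p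

/-- `p ∘ σ_α`, where `σ_α(x) = x - 2 ⟨x, α⟩ α / |α|²`. -/
def reflect (α : Plane) : Poly →ₐ[ℂ] Poly :=
  aeval fun i => X i - C ((2 * α i / ‖α‖ ^ 2 : ℝ) : ℂ) * linForm α

/-- The linear form `⟨α, ·⟩` divides `p - p ∘ σ_α`. -/
theorem linForm_dvd_sub_reflect (α : Plane) (p : Poly) : linForm α ∣ p - reflect α p := by
  induction p using MvPolynomial.induction_on with
  | C c => simp [reflect, MvPolynomial.algebraMap_eq]
  | add p q hp hq =>
    have h : p + q - reflect α (p + q) = (p - reflect α p) + (q - reflect α q) := by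
      rw [map_add]; ring
    rw [h]
    exact dvd_add hp hq
  | mul_X p i hp =>
    have h : p * X i - reflect α (p * X i)
        = (p - reflect α p) * reflect α (X i) + p * (X i - reflect α (X i)) := by
      rw [map_mul]; ring
    rw [h]
    refine dvd_add (hp.mul_right _) (Dvd.dvd.mul_left ?_ _)
    simp [reflect]

/-- The polynomial `(p(x) - p(σ_α x)) / ⟨α, x⟩`. -/
def divDiff (α : Plane) (p : Poly) : Poly := Classical.choose (linForm_dvd_sub_reflect α p)

/-- The directional derivative `∂_ξ`. -/
def dirDeriv (ξ : Plane) (p : Poly) : Poly := ∑ i, C (ξ i : ℂ) * pderiv i p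

/-- The Dunkl operator `T_ξ(k)` of the dihedral group, for a constant parameter `k`. -/
def dunklOp (n : ℕ) (k : ℂ) (ξ : Plane) (p : Poly) : Poly :=
  dirDeriv ξ p +
    ∑ j ∈ Finset.range n, C (k * (inner ℝ (root n j) ξ : ℝ)) * divDiff (root n j) p

/-- `V` is an intertwining operator: a linear automorphism of the space of polynomials that
preserves homogeneity and degree, fixes `1` and satisfies `T_ξ V = V ∂_ξ` for all `ξ`. -/
structure IsIntertwining (n : ℕ) (k : ℂ) (V : Poly ≃ₗ[ℂ] Poly) : Prop where
  homogeneous : ∀ (m : ℕ) (p : Poly), p.IsHomogeneous m → (V p).IsHomogeneous m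
  map_one : V 1 = 1
  intertwines : ∀ (ξ : Plane) (p : Poly), dunklOp n k ξ (V p) = V (dirDeriv ξ p)

/-- The intertwining operator `V_k` (meaningful whenever one exists). -/
def intertwiner (n : ℕ) (k : ℂ) : Poly ≃ₗ[ℂ] Poly := Classical.epsilon (IsIntertwining n k)

/-- The homogeneous component `E_m(x, y) = V_k(⟨·, y⟩ ^ m)(x) / m!` of the Dunkl kernel. -/
def dunklE (n : ℕ) (k : ℂ) (m : ℕ) (x y : Plane) : ℂ :=
  1 / (m.factorial : ℂ) * evalAt x (intertwiner n k (linForm y ^ m))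

/-! ### The group differential system -/

/-- The number `γ = n k`. -/
def gam (n : ℕ) (k : ℂ) : ℂ := n * k

/-- The function `g`. -/
def gFun (n : ℕ) (x y : Plane) (z : ℂ) : ℂ :=
  (∑ i ∈ Finset.range n,
      (inner ℝ (rot n i x) y : ℂ) / (1 - z * (inner ℝ (rot n i x) y : ℂ))) +
    ∑ i ∈ Finset.range n,
      (inner ℝ (rot n i (sigma x)) y : ℂ) / (1 - z * (inner ℝ (rot n i (sigma x)) y : ℂ))

/-- The function `g_s`. -/
def gsFun (n : ℕ) (x y : Plane) (z : ℂ) : ℂ :=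
  (∑ i ∈ Finset.range n,
      (inner ℝ (rot n i x) y : ℂ) / (1 - z * (inner ℝ (rot n i x) y : ℂ))) -
    ∑ i ∈ Finset.range n,
      (inner ℝ (rot n i (sigma x)) y : ℂ) / (1 - z * (inner ℝ (rot n i (sigma x)) y : ℂ))

/-- The matrix of the group differential system. -/
def sysMatrix (n : ℕ) (k : ℂ) (x y : Plane) (z : ℂ) : Matrix (Fin 2) (Fin 2) ℂ :=
  !![gam n k / (2 * n) * gFun n x y z, -(gam n k / (2 * n) * gsFun n x y z);
    gam n k / (2 * n) * gsFun n x y z,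
      -(2 * gam n k / z + gam n k / (2 * n) * gFun n x y z)]

/-- `X` is holomorphic on the open neighbourhood `U` of `0`, vanishes at `0`, and solves the
group differential system on `U \ {0}`. -/
structure IsVanishingSolution (n : ℕ) (k : ℂ) (x y : Plane) (U : Set ℂ) (X : ℂ → Fin 2 → ℂ) :
    Prop where
  holomorphic : DifferentiableOn ℂ X U
  vanishes : X 0 = 0
  solves : ∀ z ∈ U, z ≠ 0 →
    HasDerivAt X (![gFun n x y z, gsFun n x y z] + (sysMatrix n k x y z).mulVec (X z)) z

/-- The open disc of centre `0` and radius `1 / c`, which is the whole plane if `c = 0`. -/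
def disc (c : ℝ) : Set ℂ := {z | c * ‖z‖ < 1}

/-- The matrices `B_p`. -/
def coeffB (n : ℕ) (k : ℂ) (x y : Plane) (p : ℕ) : Matrix (Fin 2) (Fin 2) ℂ :=
  (gam n k / (2 * n)) • ∑ i ∈ Finset.range n,
    let u : ℂ := (inner ℝ (rot n i x) y : ℂ) ^ (p + 1)
    let v : ℂ := (inner ℝ (rot n i (sigma x)) y : ℂ) ^ (p + 1)
    !![u + v, -(u - v); u - v, -(u + v)]

/-- The vectors `A_p`. -/
def coeffA (n : ℕ) (k : ℂ) (x y : Plane) : ℕ → Fin 2 → ℂ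
  | 0 => ![2 * n / gam n k, 0]
  | p + 1 =>
    (!![1 / ((p : ℂ) + 1), 0; 0, 1 / ((p : ℂ) + 1 + 2 * gam n k)]).mulVec
      (∑ i : Fin (p + 1), (coeffB n k x y (p - i)).mulVec (coeffA n k x y i))
  termination_by p => p
  decreasing_by exact i.2

/-- The function `Q(z) = ∑_{p ≥ 1} z ^ p A_p`. -/
def solQ (n : ℕ) (k : ℂ) (x y : Plane) (z : ℂ) : Fin 2 → ℂ :=
  ∑' p : ℕ, z ^ (p + 1) • coeffA n k x y (p + 1)

/-- The function `Φ = 2 n / γ + Q₁ - Q₂`. -/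
def Phi (n : ℕ) (k : ℂ) (z : ℂ) (x y : Plane) : ℂ :=
  2 * n / gam n k + solQ n k x y z 0 - solQ n k x y z 1

/-- The Pochhammer symbol `(c)_m = c (c + 1) ⋯ (c + m - 1)`. -/
def poch (c : ℂ) (m : ℕ) : ℂ := ∏ j ∈ Finset.range m, (c + j)

end

end DihedralDunkl

/-! Let `S` be the sum of the `n` reflections acting on polynomials. Euler's identity for Dunkl
operators (`sum_X_mul_dunklOp`) says that `∑ xᵢ Tᵢ` acts on degree `m` as `(m + γ) - k S`. An
intertwiner must therefore satisfy `((m + γ) - k S) V p = ∑ xᵢ V (∂ᵢ p)`. A product of three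
reflections is a reflection, so `S³ = n² S`. Hence `(m + γ) - k S` is annihilated by the polynomial
with roots `m + γ`, `m`, `m + 2γ`, all nonzero for `m ≥ 1` by the hypothesis on `γ`. The equation
thus determines `V` degree by degree, which gives uniqueness and a candidate. For the candidate, the
defect `T_ξ V p - V ∂_ξ p`, as a family indexed by `ξ`, satisfies `c Z = k S' Z` with `S'` the
diagonal reflection sum. Again `S'³ = n² S'`, so the defect vanishes (`dunklOp_eq_of_smul_sub`).

Applied to powers of `⟨·, y⟩`, the same equation becomes a recursion for `E_m` (`dunklE_succ`) whose
only nonlocal term is the sum of `E_m` over the coset of reflections. Solving it and summing over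
the rotations and over the reflections closes up into two coupled recursions. In the sum and the
difference of the two coset sums these are exactly the recursion for `A_p`, whence `A_p = (γ)_p / γ
· (rotE + reflE, rotE - reflE)` (`coeffA_eq`). So `Φ` generates `(2/γ) (γ)_p reflE_p`, and division
by `1 - z⟨x, y⟩` performs the convolution that recovers `E_m`. The integral formula is Cauchy's
formula for these coefficients.

A geometric bound on `A_p` (`norm_coeffA_le`) gives convergence and `δ`. The recursion for `A_p`,
summed against `z ^ p`, is the differential system. Uniqueness holds because the leading coefficient
of a nonzero difference of solutions, of order `p ≥ 1`, would be killed by `diag(p, p + 2γ)`. -/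

namespace DihedralDunkl

noncomputable section

/-! ### Algebra: the intertwining operator and the recursion for the Dunkl kernel. -/

section Algebra

open MvPolynomial

/-! ### Sums over a period and sums of reflections -/

theorem sum_range_add_of_periodic {A : Type*} [AddCommGroup A] {n : ℕ} {F : ℤ → A}
    (hF : ∀ j, F (j + n) = F j) (c : ℤ) :
    ∑ i ∈ Finset.range n, F (i + c) = ∑ i ∈ Finset.range n, F i := by
  have step : ∀ c : ℤ, ∑ i ∈ Finset.range n, F (i + (c + 1)) = ∑ i ∈ Finset.range n, F (i + c) := by
    intro c
    have h1 := Finset.sum_range_succ (fun i : ℕ => F (i + c)) n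
    rw [Finset.sum_range_succ'] at h1
    have h2 : F ((n : ℤ) + c) = F (((0 : ℕ) : ℤ) + c) := by
      rw [add_comm, hF]; simp
    rw [h2] at h1
    rw [← add_right_cancel h1]
    refine Finset.sum_congr rfl fun i _ => ?_
    congr 1
    push_cast
    ring
  induction c using Int.induction_on with
  | zero => simp
  | succ i ih => rw [step, ih]
  | pred i ih => rw [← ih, ← step (-i - 1)]; simp

theorem sum_range_sub_of_periodic {A : Type*} [AddCommGroup A] {n : ℕ} {F : ℤ → A}
    (hF : ∀ j, F (j + n) = F j) (c : ℤ) :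
    ∑ i ∈ Finset.range n, F (c - i) = ∑ i ∈ Finset.range n, F i := by
  rw [← Finset.sum_range_reflect, ← sum_range_add_of_periodic hF (c - n + 1)]
  refine Finset.sum_congr rfl fun i hi => ?_
  have := Finset.mem_range.1 hi
  congr 1
  omega

section ReflectionSum

variable {E : Type*} [AddCommGroup E] [Module ℂ E]

/-- The sum of the first `n` members of a family of operators. -/
def opSum (n : ℕ) (ρ : ℤ → E →ₗ[ℂ] E) : E →ₗ[ℂ] E := ∑ j ∈ Finset.range n, ρ j

theorem opSum_apply (n : ℕ) (ρ : ℤ → E →ₗ[ℂ] E) (v : E) :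
    opSum n ρ v = ∑ j ∈ Finset.range n, ρ j v := by
  simp [opSum]

variable {n : ℕ} {ρ : ℤ → E →ₗ[ℂ] E}

/-- For fixed `a`, `b`, the product `ρ a ρ b ρ c` runs once through the whole family as `c` does, so
each of the `n²` pairs contributes one copy of the sum. -/
theorem opSum_cube (hper : ∀ j, ρ (j + n) = ρ j)
    (htri : ∀ a b c v, ρ a (ρ b (ρ c v)) = ρ (a - b + c) v) (v : E) :
    opSum n ρ (opSum n ρ (opSum n ρ v)) = ((n : ℂ) ^ 2) • opSum n ρ v := by
  have h : ∀ a b : ℤ, ∑ c ∈ Finset.range n, ρ a (ρ b (ρ c v)) = opSum n ρ v := by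
    intro a b
    have := sum_range_add_of_periodic (n := n) (F := fun j => ρ j v) (fun j => by simp [hper]) (a - b)
    rw [opSum_apply, ← this]
    refine Finset.sum_congr rfl fun c _ => ?_
    rw [htri, add_comm]
  simp only [opSum_apply] at h ⊢
  simp only [map_sum, h]
  rw [Finset.sum_const, Finset.sum_const, Finset.card_range, ← Nat.cast_smul_eq_nsmul ℂ,
    ← Nat.cast_smul_eq_nsmul ℂ, smul_smul, sq]

/-- Applying `S` twice to `c v = k S v` and using `S³ = n² S` gives `(c² - n²k²) S v = 0`, so `S v =
0` and then `c v = 0`. With `c = m + γ` the factor is `m (m + 2γ)`. -/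
theorem eq_zero_of_smul_eq_smul_opSum (hper : ∀ j, ρ (j + n) = ρ j)
    (htri : ∀ a b c v, ρ a (ρ b (ρ c v)) = ρ (a - b + c) v) {c k : ℂ} (hc : c ≠ 0)
    (hd : c ^ 2 - (n * k) ^ 2 ≠ 0) {v : E} (hv : c • v = k • opSum n ρ v) : v = 0 := by
  have h1 : c • opSum n ρ v = k • opSum n ρ (opSum n ρ v) := by
    rw [← map_smul, hv, map_smul]
  have h2 : c • opSum n ρ (opSum n ρ v) = k • ((n : ℂ) ^ 2) • opSum n ρ v := by
    rw [← opSum_cube hper htri, ← map_smul, h1, map_smul]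
  have h3 : (c ^ 2 - (n * k) ^ 2) • opSum n ρ v = 0 := by
    rw [sub_smul, sq, mul_smul, h1, smul_comm c k, h2, smul_smul, smul_smul, ← sub_smul]
    convert zero_smul ℂ _ using 2
    ring
  have h4 : opSum n ρ v = 0 := (smul_eq_zero.1 h3).resolve_left hd
  rw [h4, smul_zero] at hv
  exact (smul_eq_zero.1 hv).resolve_left hc

/-- The inverse of `c - k S`, where `S` is the sum of the operators `ρ`. -/
def resolv (n : ℕ) (ρ : ℤ → E →ₗ[ℂ] E) (c k : ℂ) : E →ₗ[ℂ] E :=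
  c⁻¹ • LinearMap.id + (k / (c ^ 2 - (n * k) ^ 2)) • opSum n ρ +
    (k ^ 2 / (c * (c ^ 2 - (n * k) ^ 2))) • (opSum n ρ ∘ₗ opSum n ρ)

/-- Since `S³ = n² S`, the inverse of `c - k S` can be sought among quadratic polynomials in `S`;
comparing coefficients gives `resolv`. -/
theorem smul_resolv_sub (hper : ∀ j, ρ (j + n) = ρ j)
    (htri : ∀ a b c v, ρ a (ρ b (ρ c v)) = ρ (a - b + c) v) {c k : ℂ} (hc : c ≠ 0)
    (hd : c ^ 2 - (n * k) ^ 2 ≠ 0) (v : E) :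
    c • resolv n ρ c k v - k • opSum n ρ (resolv n ρ c k v) = v := by
  simp only [resolv, LinearMap.add_apply, LinearMap.smul_apply, LinearMap.id_apply, map_add,
    map_smul, LinearMap.comp_apply, opSum_cube hper htri]
  generalize hD : c ^ 2 - (n * k) ^ 2 = d at *
  match_scalars
  · field_simp
  · field_simp
    linear_combination k * hD
  · field_simp
    ring

end ReflectionSum

/-! ### Reflections of the plane and of polynomials, by angle -/

/-- The reflection `z ↦ exp (i φ) * conj z` of the plane. -/
def reflPt (φ : ℝ) (x : Plane) : Plane :=
  !₂[Real.cos φ * x 0 + Real.sin φ * x 1, Real.sin φ * x 0 - Real.cos φ * x 1]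

/-- The rotation of the plane by the angle `φ`. -/
def rotPt (φ : ℝ) (x : Plane) : Plane :=
  !₂[Real.cos φ * x 0 - Real.sin φ * x 1, Real.sin φ * x 0 + Real.cos φ * x 1]

/-- The action of `reflPt φ` on polynomials. -/
def reflPoly (φ : ℝ) : Poly →ₐ[ℂ] Poly :=
  aeval ![C (Real.cos φ : ℂ) * X 0 + C (Real.sin φ : ℂ) * X 1,
    C (Real.sin φ : ℂ) * X 0 - C (Real.cos φ : ℂ) * X 1]

/-- The unit vector `i exp (i θ)`. -/
def unitVec (θ : ℝ) : Plane := !₂[-Real.sin θ, Real.cos θ]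

@[simp] theorem reflPt_zero (φ : ℝ) (x : Plane) :
    reflPt φ x 0 = Real.cos φ * x 0 + Real.sin φ * x 1 := by simp [reflPt]

@[simp] theorem reflPt_one (φ : ℝ) (x : Plane) :
    reflPt φ x 1 = Real.sin φ * x 0 - Real.cos φ * x 1 := by simp [reflPt]

@[simp] theorem rotPt_zero (φ : ℝ) (x : Plane) :
    rotPt φ x 0 = Real.cos φ * x 0 - Real.sin φ * x 1 := by simp [rotPt]

@[simp] theorem rotPt_one (φ : ℝ) (x : Plane) :
    rotPt φ x 1 = Real.sin φ * x 0 + Real.cos φ * x 1 := by simp [rotPt]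

@[simp] theorem unitVec_zero (θ : ℝ) : unitVec θ 0 = -Real.sin θ := by simp [unitVec]

@[simp] theorem unitVec_one (θ : ℝ) : unitVec θ 1 = Real.cos θ := by simp [unitVec]

@[simp] theorem reflPoly_X_zero (φ : ℝ) : reflPoly φ (X 0) =
    C (Real.cos φ : ℂ) * X 0 + C (Real.sin φ : ℂ) * X 1 := by simp [reflPoly]

@[simp] theorem reflPoly_X_one (φ : ℝ) : reflPoly φ (X 1) =
    C (Real.sin φ : ℂ) * X 0 - C (Real.cos φ : ℂ) * X 1 := by simp [reflPoly]

@[simp] theorem reflPoly_C (φ : ℝ) (c : ℂ) : reflPoly φ (C c) = C c := by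
  simp [reflPoly, algebraMap_eq]

theorem plane_ext {x y : Plane} (h0 : x 0 = y 0) (h1 : x 1 = y 1) : x = y := by
  ext i
  fin_cases i
  · exact h0
  · exact h1

theorem poly_algHom_ext {f g : Poly →ₐ[ℂ] Poly} (h0 : f (X 0) = g (X 0)) (h1 : f (X 1) = g (X 1)) :
    f = g := by
  refine MvPolynomial.algHom_ext fun i => ?_
  fin_cases i
  · exact h0
  · exact h1

theorem inner_plane (x y : Plane) : inner ℝ x y = x 0 * y 0 + x 1 * y 1 := by
  simp [PiLp.inner_apply, Fin.sum_univ_two, mul_comm]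

theorem linForm_eq (y : Plane) : linForm y = C (y 0 : ℂ) * X 0 + C (y 1 : ℂ) * X 1 := by
  simp [linForm, Fin.sum_univ_two]

theorem dirDeriv_eq (ξ : Plane) (p : Poly) :
    dirDeriv ξ p = C (ξ 0 : ℂ) * pderiv 0 p + C (ξ 1 : ℂ) * pderiv 1 p := by
  simp [dirDeriv, Fin.sum_univ_two]

theorem linForm_neg (y : Plane) : linForm (-y) = -linForm y := by
  simp [linForm]

theorem linForm_unitVec_ne_zero (θ : ℝ) : linForm (unitVec θ) ≠ 0 := by
  intro h
  have := congrArg (evalAt (unitVec θ)) h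
  simp only [linForm_eq, evalAt, map_add, map_mul, eval_C, eval_X, map_zero, unitVec_zero,
    unitVec_one] at this
  have h2 : Real.sin θ ^ 2 + Real.cos θ ^ 2 = 0 := by
    have : ((Real.sin θ ^ 2 + Real.cos θ ^ 2 : ℝ) : ℂ) = 0 := by
      rw [← this]; push_cast; ring
    exact_mod_cast this
  rw [Real.sin_sq_add_cos_sq] at h2
  exact one_ne_zero h2

theorem norm_unitVec_sq (θ : ℝ) : ‖unitVec θ‖ ^ 2 = 1 := by
  rw [EuclideanSpace.norm_sq_eq]
  simp [Fin.sum_univ_two]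

theorem reflect_unitVec (θ : ℝ) : reflect (unitVec θ) = reflPoly (2 * θ) := by
  apply poly_algHom_ext
  · simp only [reflect, aeval_X, norm_unitVec_sq, linForm_eq, reflPoly_X_zero, unitVec_zero,
      unitVec_one, Real.cos_two_mul', Real.sin_two_mul]
    have h : (C ((Real.cos θ : ℝ) : ℂ) : Poly) ^ 2 = 1 - C ((Real.sin θ : ℝ) : ℂ) ^ 2 := by
      rw [← map_pow, ← map_pow, ← C_1, ← map_sub]
      congr 1
      exact_mod_cast Real.cos_sq' θ
    simp only [div_one, Complex.ofReal_sub, Complex.ofReal_mul, Complex.ofReal_neg,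
      Complex.ofReal_pow, Complex.ofReal_ofNat, map_sub, map_mul, map_neg, map_pow, map_ofNat]
    linear_combination (-X 0) * h
  · simp only [reflect, aeval_X, norm_unitVec_sq, linForm_eq, reflPoly_X_one, unitVec_zero,
      unitVec_one, Real.cos_two_mul', Real.sin_two_mul]
    have h : (C ((Real.cos θ : ℝ) : ℂ) : Poly) ^ 2 = 1 - C ((Real.sin θ : ℝ) : ℂ) ^ 2 := by
      rw [← map_pow, ← map_pow, ← C_1, ← map_sub]
      congr 1
      exact_mod_cast Real.cos_sq' θ
    simp only [div_one, Complex.ofReal_sub, Complex.ofReal_mul, Complex.ofReal_neg,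
      Complex.ofReal_pow, Complex.ofReal_ofNat, map_sub, map_mul, map_neg, map_pow, map_ofNat]
    linear_combination (-X 1) * h

theorem reflPoly_triple (a b c : ℝ) (p : Poly) :
    reflPoly a (reflPoly b (reflPoly c p)) = reflPoly (a - b + c) p := by
  have h : ((reflPoly a).comp ((reflPoly b).comp (reflPoly c))) = reflPoly (a - b + c) := by
    apply poly_algHom_ext <;>
    · simp only [AlgHom.comp_apply, reflPoly_X_zero, reflPoly_X_one, map_add, map_sub, map_mul,
        reflPoly_C, Real.cos_add, Real.sin_add, Real.cos_sub, Real.sin_sub, Complex.ofReal_add,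
        Complex.ofReal_sub, Complex.ofReal_mul]
      ring
  exact DFunLike.congr_fun h p

/-- Both composites are induced by a rotation through the same angle, because `φ - 2θ = 2(φ - θ) -
φ`. -/
theorem reflPoly_mul_comm (φ θ : ℝ) (p : Poly) :
    reflPoly φ (reflPoly (2 * θ) p) = reflPoly (2 * (φ - θ)) (reflPoly φ p) := by
  have h : (reflPoly φ).comp (reflPoly (2 * θ)) = (reflPoly (2 * (φ - θ))).comp (reflPoly φ) := by
    have e : φ - 2 * θ = 2 * (φ - θ) - φ := by ring
    have hc := congrArg Real.cos e
    have hs := congrArg Real.sin e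
    rw [Real.cos_sub, Real.cos_sub] at hc
    rw [Real.sin_sub, Real.sin_sub] at hs
    have hc' := congrArg (fun t : ℝ => (C (t : ℂ) : Poly)) hc
    have hs' := congrArg (fun t : ℝ => (C (t : ℂ) : Poly)) hs
    simp only [map_add, map_sub, map_mul, Complex.ofReal_add,
        Complex.ofReal_sub, Complex.ofReal_mul] at hc' hs'
    apply poly_algHom_ext
    · simp only [AlgHom.comp_apply, reflPoly_X_zero, reflPoly_X_one, map_add, map_mul,
        reflPoly_C]
      linear_combination X 0 * hc' + X 1 * hs'
    · simp only [AlgHom.comp_apply, reflPoly_X_zero, reflPoly_X_one, map_sub, map_mul,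
        reflPoly_C]
      linear_combination X 1 * hc' - X 0 * hs'
  exact DFunLike.congr_fun h p

theorem reflPt_triple (a b c : ℝ) (x : Plane) :
    reflPt a (reflPt b (reflPt c x)) = reflPt (a - b + c) x := by
  apply plane_ext <;>
  · simp only [reflPt_zero, reflPt_one, Real.cos_add, Real.sin_add, Real.cos_sub, Real.sin_sub]
    ring

theorem reflPt_rotPt (a b : ℝ) (x : Plane) : reflPt a (rotPt b x) = reflPt (a - b) x := by
  apply plane_ext <;>
  · simp only [reflPt_zero, reflPt_one, rotPt_zero, rotPt_one, Real.cos_sub, Real.sin_sub]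
    ring

theorem reflPt_reflPt (a b : ℝ) (x : Plane) : reflPt a (reflPt b x) = rotPt (a - b) x := by
  apply plane_ext <;>
  · simp only [reflPt_zero, reflPt_one, rotPt_zero, rotPt_one, Real.cos_sub, Real.sin_sub]
    ring

theorem evalAt_reflPoly (φ : ℝ) (x : Plane) (p : Poly) :
    evalAt x (reflPoly φ p) = evalAt (reflPt φ x) p := by
  induction p using MvPolynomial.induction_on with
  | C c => simp [evalAt]
  | add p q hp hq => simp only [evalAt, map_add] at *; rw [hp, hq]
  | mul_X p i hp =>
    simp only [evalAt, map_mul] at *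
    rw [hp]
    congr 1
    fin_cases i
    · simp
    · simp

theorem dirDeriv_mul (ξ : Plane) (p q : Poly) :
    dirDeriv ξ (p * q) = dirDeriv ξ p * q + p * dirDeriv ξ q := by
  simp only [dirDeriv_eq, Derivation.leibniz, smul_eq_mul]
  ring

theorem dirDeriv_add (ξ : Plane) (p q : Poly) :
    dirDeriv ξ (p + q) = dirDeriv ξ p + dirDeriv ξ q := by
  simp only [dirDeriv_eq, map_add]
  ring

theorem dirDeriv_X (ξ : Plane) (i : Fin 2) : dirDeriv ξ (X i) = C (ξ i : ℂ) := by
  have h01 : (pderiv (0 : Fin 2)) (X 1 : Poly) = 0 := pderiv_X_of_ne (by decide)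
  have h10 : (pderiv (1 : Fin 2)) (X 0 : Poly) = 0 := pderiv_X_of_ne (by decide)
  fin_cases i
  · simp [dirDeriv_eq, h10]
  · simp [dirDeriv_eq, h01]

theorem dirDeriv_C (ξ : Plane) (c : ℂ) : dirDeriv ξ (C c) = 0 := by
  simp [dirDeriv]

theorem dirDeriv_reflPoly (φ : ℝ) (ξ : Plane) (p : Poly) :
    dirDeriv ξ (reflPoly φ p) = reflPoly φ (dirDeriv (reflPt φ ξ) p) := by
  induction p using MvPolynomial.induction_on with
  | C c => simp [dirDeriv]
  | add p q hp hq => rw [map_add, dirDeriv_add, dirDeriv_add, hp, hq, map_add]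
  | mul_X p i hp =>
    have hX : dirDeriv ξ (reflPoly φ (X i)) = reflPoly φ (dirDeriv (reflPt φ ξ) (X i)) := by
      fin_cases i
      · simp only [Fin.zero_eta, reflPoly_X_zero, dirDeriv_add, dirDeriv_mul, dirDeriv_C,
          dirDeriv_X, reflPt_zero, reflPoly_C, Complex.ofReal_add, Complex.ofReal_mul, map_add,
          map_mul]
        ring
      · simp only [Fin.mk_one, reflPoly_X_one, sub_eq_add_neg, ← neg_mul, ← map_neg,
          dirDeriv_add, dirDeriv_mul, dirDeriv_C, ← Complex.ofReal_neg,
          dirDeriv_X, reflPt_one, reflPoly_C, Complex.ofReal_add, Complex.ofReal_mul, map_add,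
          map_mul]
        ring
    rw [map_mul, dirDeriv_mul, dirDeriv_mul, hp, hX, map_add, map_mul, map_mul]

/-! ### Divided differences and Dunkl operators -/

theorem linForm_mul_divDiff (α : Plane) (p : Poly) :
    linForm α * divDiff α p = p - reflect α p :=
  (Classical.choose_spec (linForm_dvd_sub_reflect α p)).symm

/-- `divDiff` is obtained by choice; cancelling the nonzero linear form makes the quotient unique.
All rules for `divDiff` below are proved through this criterion. -/
theorem divDiff_unitVec_eq {θ : ℝ} {p d : Poly}
    (h : linForm (unitVec θ) * d = p - reflPoly (2 * θ) p) : divDiff (unitVec θ) p = d := by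
  apply mul_left_cancel₀ (linForm_unitVec_ne_zero θ)
  rw [linForm_mul_divDiff, h, reflect_unitVec]

theorem linForm_mul_divDiff_unitVec (θ : ℝ) (p : Poly) :
    linForm (unitVec θ) * divDiff (unitVec θ) p = p - reflPoly (2 * θ) p := by
  rw [linForm_mul_divDiff, reflect_unitVec]

theorem divDiff_unitVec_add (θ : ℝ) (p q : Poly) :
    divDiff (unitVec θ) (p + q) = divDiff (unitVec θ) p + divDiff (unitVec θ) q := by
  apply divDiff_unitVec_eq
  rw [mul_add, linForm_mul_divDiff_unitVec, linForm_mul_divDiff_unitVec, map_add]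
  ring

theorem divDiff_unitVec_C_mul (θ : ℝ) (c : ℂ) (p : Poly) :
    divDiff (unitVec θ) (C c * p) = C c * divDiff (unitVec θ) p := by
  apply divDiff_unitVec_eq
  rw [mul_left_comm, linForm_mul_divDiff_unitVec, map_mul, reflPoly_C]
  ring

theorem reflPoly_linForm (φ : ℝ) (v : Plane) :
    reflPoly φ (linForm v) = linForm (reflPt φ v) := by
  simp [linForm_eq]
  ring

theorem reflPt_unitVec (φ θ : ℝ) : reflPt φ (unitVec θ) = -unitVec (φ - θ) := by
  apply plane_ext
  · simp [Real.sin_sub]; ring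
  · simp [Real.cos_sub]; ring

theorem divDiff_unitVec_reflPoly (φ θ : ℝ) (p : Poly) :
    divDiff (unitVec (φ - θ)) (reflPoly φ p) = -reflPoly φ (divDiff (unitVec θ) p) := by
  apply divDiff_unitVec_eq
  have h := congrArg (reflPoly φ) (linForm_mul_divDiff_unitVec θ p)
  rw [map_mul, reflPoly_linForm, reflPt_unitVec, linForm_neg, map_sub, reflPoly_mul_comm] at h
  rw [← h]
  ring

theorem unitVec_add_pi (θ : ℝ) : unitVec (θ + Real.pi) = -unitVec θ := by
  apply plane_ext <;> simp

theorem divDiff_unitVec_add_pi (θ : ℝ) (p : Poly) :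
    divDiff (unitVec (θ + Real.pi)) p = -divDiff (unitVec θ) p := by
  apply divDiff_unitVec_eq
  have e : reflPoly (2 * (θ + Real.pi)) = reflPoly (2 * θ) := by
    simp only [mul_add, reflPoly, Real.cos_add_two_pi, Real.sin_add_two_pi]
  rw [unitVec_add_pi, linForm_neg, neg_mul_neg, linForm_mul_divDiff_unitVec, e]

theorem linForm_unitVec_mul (θ : ℝ) : ∀ i : Fin 2,
    X i - reflPoly (2 * θ) (X i) = C ((2 * unitVec θ i : ℝ) : ℂ) * linForm (unitVec θ) := by
  intro i
  rw [← reflect_unitVec]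
  simp [reflect, norm_unitVec_sq]

/-- The twisted Leibniz rule, from `xp - (sx)(sp) = x (p - sp) + (x - sx) sp`. -/
theorem divDiff_unitVec_X_mul (θ : ℝ) (i : Fin 2) (p : Poly) :
    divDiff (unitVec θ) (X i * p) =
      X i * divDiff (unitVec θ) p + C ((2 * unitVec θ i : ℝ) : ℂ) * reflPoly (2 * θ) p := by
  apply divDiff_unitVec_eq
  have h := linForm_unitVec_mul θ i
  rw [map_mul, mul_add, mul_left_comm, linForm_mul_divDiff_unitVec]
  linear_combination (-reflPoly (2 * θ) p) * h

/-- The angle of the `j`-th root. -/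
def ang (n : ℕ) (j : ℤ) : ℝ := Real.pi * j / n

theorem root_eq (n j : ℕ) : root n j = unitVec (ang n j) := by
  simp [root, unitVec, ang]

theorem ang_add {n : ℕ} (hn : n ≠ 0) (j : ℤ) : ang n (j + n) = ang n j + Real.pi := by
  have : (n : ℝ) ≠ 0 := by exact_mod_cast hn
  simp only [ang]
  push_cast
  field_simp

theorem ang_sub (n : ℕ) (a b : ℤ) : ang n (a - b) = ang n a - ang n b := by
  simp only [ang]
  push_cast
  ring

theorem ang_triple (n : ℕ) (a b c : ℤ) :
    2 * ang n (a - b + c) = 2 * ang n a - 2 * ang n b + 2 * ang n c := by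
  simp only [ang]
  push_cast
  ring

/-- The action of the reflection `r ^ j σ` on polynomials, for an integer `j`. -/
def reflOp (n : ℕ) (j : ℤ) : Poly →ₗ[ℂ] Poly := (reflPoly (2 * ang n j)).toLinearMap

theorem reflOp_apply (n : ℕ) (j : ℤ) (p : Poly) : reflOp n j p = reflPoly (2 * ang n j) p := rfl

theorem reflPoly_ang_add {n : ℕ} (hn : n ≠ 0) (j : ℤ) :
    reflPoly (2 * ang n (j + n)) = reflPoly (2 * ang n j) := by
  simp only [ang_add hn, mul_add, reflPoly, Real.cos_add_two_pi, Real.sin_add_two_pi]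

theorem reflPt_ang_add {n : ℕ} (hn : n ≠ 0) (j : ℤ) :
    reflPt (2 * ang n (j + n)) = reflPt (2 * ang n j) := by
  funext x
  simp only [ang_add hn, mul_add, reflPt, Real.cos_add_two_pi, Real.sin_add_two_pi]

theorem rotPt_ang_add {n : ℕ} (hn : n ≠ 0) (j : ℤ) :
    rotPt (2 * ang n (j + n)) = rotPt (2 * ang n j) := by
  funext x
  simp only [ang_add hn, mul_add, rotPt, Real.cos_add_two_pi, Real.sin_add_two_pi]

theorem reflOp_add {n : ℕ} (hn : n ≠ 0) (j : ℤ) : reflOp n (j + n) = reflOp n j := by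
  simp only [reflOp, reflPoly_ang_add hn]

theorem reflOp_triple (n : ℕ) (a b c : ℤ) (p : Poly) :
    reflOp n a (reflOp n b (reflOp n c p)) = reflOp n (a - b + c) p := by
  simp only [reflOp_apply, reflPoly_triple, ang_triple]

/-- The diagonal action of the reflection `r ^ j σ` on families of polynomials indexed by
vectors. -/
def reflFamOp (n : ℕ) (j : ℤ) : (Plane → Poly) →ₗ[ℂ] (Plane → Poly) where
  toFun Z ξ := reflOp n j (Z (reflPt (2 * ang n j) ξ))
  map_add' _ _ := by funext ξ; simp
  map_smul' _ _ := by funext ξ; simp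

theorem reflFamOp_apply (n : ℕ) (j : ℤ) (Z : Plane → Poly) (ξ : Plane) :
    reflFamOp n j Z ξ = reflOp n j (Z (reflPt (2 * ang n j) ξ)) := rfl

theorem reflFamOp_add {n : ℕ} (hn : n ≠ 0) (j : ℤ) : reflFamOp n (j + n) = reflFamOp n j := by
  ext1 Z
  funext ξ
  simp only [reflFamOp_apply, reflOp_add hn, reflPt_ang_add hn]

theorem reflFamOp_triple (n : ℕ) (a b c : ℤ) (Z : Plane → Poly) :
    reflFamOp n a (reflFamOp n b (reflFamOp n c Z)) = reflFamOp n (a - b + c) Z := by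
  funext ξ
  simp only [reflFamOp_apply, reflOp_triple, reflPt_triple]
  -- The reflections reach the index `ξ` in the opposite order; the triple law is symmetric in `a`
  -- and `c`, so this does no harm.
  rw [show a - b + c = c - b + a by ring, ang_triple]

theorem dunklOp_eq (n : ℕ) (k : ℂ) (ξ : Plane) (p : Poly) : dunklOp n k ξ p = dirDeriv ξ p +
    ∑ j ∈ Finset.range n,
      C (k * (inner ℝ (unitVec (ang n j)) ξ : ℝ)) * divDiff (unitVec (ang n j)) p := by
  simp only [dunklOp, root_eq]

/-- The Dunkl operator as a linear map. -/
def dunklLin (n : ℕ) (k : ℂ) (ξ : Plane) : Poly →ₗ[ℂ] Poly where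
  toFun := dunklOp n k ξ
  map_add' p q := by
    simp only [dunklOp_eq, dirDeriv_add, divDiff_unitVec_add, mul_add, Finset.sum_add_distrib]
    ring
  map_smul' c p := by
    simp only [dunklOp_eq, smul_eq_C_mul, divDiff_unitVec_C_mul, dirDeriv_mul, mul_add,
      RingHom.id_apply, Finset.mul_sum]
    congr 1
    · simp [dirDeriv]
    · exact Finset.sum_congr rfl fun _ _ => by ring

/-! ### Equivariance, commutation with coordinates and Euler's identity. -/

theorem dunklLin_apply (n : ℕ) (k : ℂ) (ξ : Plane) (p : Poly) :
    dunklLin n k ξ p = dunklOp n k ξ p := rfl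

theorem inner_unitVec_reflPt (φ θ : ℝ) (ξ : Plane) :
    inner ℝ (unitVec θ) (reflPt φ ξ) = -inner ℝ (unitVec (φ - θ)) ξ := by
  simp [inner_plane, Real.sin_sub, Real.cos_sub]
  ring

theorem dunklOp_reflOp {n : ℕ} (hn : n ≠ 0) (k : ℂ) (ξ : Plane) (b : ℤ) (p : Poly) :
    dunklOp n k ξ (reflOp n b p) = reflOp n b (dunklOp n k (reflPt (2 * ang n b) ξ) p) := by
  simp only [reflOp_apply, dunklOp_eq, map_add, map_sum, map_mul (reflPoly _), reflPoly_C,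
    dirDeriv_reflPoly]
  congr 1
  set F : ℤ → Poly := fun j => C (k * (inner ℝ (unitVec (ang n j)) ξ : ℝ)) *
    divDiff (unitVec (ang n j)) (reflPoly (2 * ang n b) p) with hF
  -- Shifting `j` by `n` replaces the root by its opposite; both factors change sign.
  have hper : ∀ j, F (j + n) = F j := by
    intro j
    simp only [hF, ang_add hn, divDiff_unitVec_add_pi]
    simp only [unitVec_add_pi, inner_neg_left]
    push_cast
    simp only [mul_neg, map_neg, neg_mul, neg_neg]
  -- Conjugation by the `b`-th reflection sends the `j`-th reflection to the one of index `2b - j`.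
  rw [← sum_range_sub_of_periodic hper (b + b)]
  refine Finset.sum_congr rfl fun j _ => ?_
  have e : ang n (b + b - j) = 2 * ang n b - ang n j := by
    simp only [ang]; push_cast; ring
  simp only [hF, e, divDiff_unitVec_reflPoly, inner_unitVec_reflPt]
  push_cast
  simp only [mul_neg, map_neg, neg_mul]

theorem dunklOp_X_mul (n : ℕ) (k : ℂ) (ξ : Plane) (i : Fin 2) (p : Poly) :
    dunklOp n k ξ (X i * p) = X i * dunklOp n k ξ p + C (ξ i : ℂ) * p +
      ∑ j ∈ Finset.range n, C (k * (inner ℝ (unitVec (ang n j)) ξ : ℝ)) *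
        (C ((2 * unitVec (ang n j) i : ℝ) : ℂ) * reflOp n j p) := by
  simp only [dunklOp_eq, divDiff_unitVec_X_mul, dirDeriv_mul, dirDeriv_X, mul_add,
    Finset.sum_add_distrib, reflOp_apply, Finset.mul_sum, mul_left_comm (X i)]
  ring

/-- The standard basis vectors. -/
abbrev stdVec (i : Fin 2) : Plane := EuclideanSpace.single i 1

theorem inner_stdVec (x : Plane) (i : Fin 2) : inner ℝ x (stdVec i) = x i := by
  fin_cases i <;> simp [inner_plane]

theorem dirDeriv_stdVec (i : Fin 2) (p : Poly) : dirDeriv (stdVec i) p = pderiv i p := by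
  fin_cases i <;> simp [dirDeriv_eq]

/-- The derivative part is Euler's identity. In the difference part `∑ xᵢ αᵢ = ⟨α, x⟩` cancels the
denominator and leaves `k ∑ (p - s_α p)`. -/
theorem sum_X_mul_dunklOp (n : ℕ) (k : ℂ) {m : ℕ} {p : Poly} (hp : p.IsHomogeneous m) :
    ∑ i, X i * dunklOp n k (stdVec i) p = ((m : ℂ) + n * k) • p - k • opSum n (reflOp n) p := by
  have euler := hp.sum_X_mul_pderiv
  have key : ∀ j : ℕ, ∑ i, X i * (C (k * (unitVec (ang n j) i : ℝ)) *
      divDiff (unitVec (ang n j)) p) = C k * p - C k * reflOp n j p := by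
    intro j
    have h := linForm_mul_divDiff_unitVec (ang n j) p
    rw [reflOp_apply, ← mul_sub, ← h]
    simp only [linForm, Finset.sum_mul, Finset.mul_sum, map_mul]
    exact Finset.sum_congr rfl fun i _ => by ring
  simp only [dunklOp_eq, dirDeriv_stdVec, mul_add, Finset.sum_add_distrib, euler, inner_stdVec,
    Finset.mul_sum]
  rw [Finset.sum_comm]
  simp only [key, Finset.sum_sub_distrib, opSum_apply, smul_eq_C_mul, Finset.mul_sum]
  simp [← Nat.cast_smul_eq_nsmul ℂ, smul_eq_C_mul]
  ring

/-! ### The intertwining operator -/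

/-- The parameter is regular: `(m + γ) - k S` is invertible for `m ≥ 1`, where `S` is the sum of
the reflections. -/
def IsRegularParam (n : ℕ) (k : ℂ) : Prop :=
  ∀ m : ℕ, (((m + 1 : ℕ) : ℂ) + n * k) ≠ 0 ∧ (((m + 1 : ℕ) : ℂ) + n * k) ^ 2 - (n * k) ^ 2 ≠ 0

theorem isRegularParam_of_gam_ne {n : ℕ} {k : ℂ} (hk : ∀ m : ℕ, gam n k ≠ -(m : ℂ) / 2) :
    IsRegularParam n k := by
  intro m
  have hm : ((m + 1 : ℕ) : ℂ) ≠ 0 := Nat.cast_ne_zero.2 (Nat.succ_ne_zero m)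
  constructor
  · intro h
    refine hk (2 * (m + 1)) ?_
    rw [gam]
    push_cast at h ⊢
    linear_combination h
  · intro h
    have h' : ((m + 1 : ℕ) : ℂ) * (((m + 1 : ℕ) : ℂ) + 2 * (n * k)) = 0 := by
      linear_combination h
    have h2 := (mul_eq_zero.1 h').resolve_left hm
    refine hk (m + 1) ?_
    rw [gam]
    linear_combination h2 / 2

theorem poly_induction_homogeneous {P : Poly → Prop}
    (homog : ∀ (m : ℕ) (p : Poly), p.IsHomogeneous m → P p)
    (add : ∀ p q, P p → P q → P (p + q)) (p : Poly) : P p := by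
  rw [← sum_homogeneousComponent p]
  exact Finset.sum_induction _ P add (homog 0 0 (isHomogeneous_zero _ _ _))
    fun i _ => homog i _ (homogeneousComponent_isHomogeneous i p)

theorem IsHomogeneous.reflPoly {m : ℕ} {p : Poly} (hp : p.IsHomogeneous m) (φ : ℝ) :
    (reflPoly φ p).IsHomogeneous m := by
  rw [← one_mul m]
  refine hp.aeval _ fun i => ?_
  fin_cases i
  · exact (isHomogeneous_C_mul_X _ _).add (isHomogeneous_C_mul_X _ _)
  · exact (isHomogeneous_C_mul_X _ _).sub (isHomogeneous_C_mul_X _ _)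

theorem opSum_mem_homogeneousSubmodule (n : ℕ) {m : ℕ} {p : Poly}
    (hp : p ∈ homogeneousSubmodule (Fin 2) ℂ m) :
    opSum n (reflOp n) p ∈ homogeneousSubmodule (Fin 2) ℂ m := by
  rw [opSum_apply]
  exact Submodule.sum_mem _ fun j _ => IsHomogeneous.reflPoly hp _

theorem resolv_mem_homogeneousSubmodule (n : ℕ) {m : ℕ} (c k : ℂ) {p : Poly}
    (hp : p ∈ homogeneousSubmodule (Fin 2) ℂ m) :
    resolv n (reflOp n) c k p ∈ homogeneousSubmodule (Fin 2) ℂ m := by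
  have h1 := opSum_mem_homogeneousSubmodule n hp
  have h2 := opSum_mem_homogeneousSubmodule n h1
  exact Submodule.add_mem _ (Submodule.add_mem _ (Submodule.smul_mem _ _ hp)
    (Submodule.smul_mem _ _ h1)) (Submodule.smul_mem _ _ h2)

theorem IsHomogeneous.dirDeriv {m : ℕ} {p : Poly} (hp : p.IsHomogeneous (m + 1)) (ξ : Plane) :
    (dirDeriv ξ p).IsHomogeneous m := by
  rw [dirDeriv_eq]
  exact (hp.pderiv.C_mul _).add (hp.pderiv.C_mul _)

/-- The intertwining operator on homogeneous polynomials of a given degree. -/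
def gradedV (n : ℕ) (k : ℂ) : ℕ → Poly →ₗ[ℂ] Poly
  | 0 => LinearMap.id
  | m + 1 => resolv n (reflOp n) (((m + 1 : ℕ) : ℂ) + n * k) k ∘ₗ
      ∑ i : Fin 2, LinearMap.mulLeft ℂ (X i) ∘ₗ gradedV n k m ∘ₗ (pderiv i).toLinearMap

theorem gradedV_succ (n : ℕ) (k : ℂ) (m : ℕ) (p : Poly) :
    gradedV n k (m + 1) p = resolv n (reflOp n) (((m + 1 : ℕ) : ℂ) + n * k) k
      (∑ i, X i * gradedV n k m (pderiv i p)) := by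
  simp [gradedV]

theorem IsHomogeneous.gradedV (n : ℕ) (k : ℂ) {m : ℕ} {p : Poly} (hp : p.IsHomogeneous m) :
    (gradedV n k m p).IsHomogeneous m := by
  induction m generalizing p with
  | zero => exact hp
  | succ m ih =>
    rw [gradedV_succ]
    apply resolv_mem_homogeneousSubmodule
    refine IsHomogeneous.sum _ _ _ fun i _ => ?_
    rw [add_comm]
    exact (isHomogeneous_X _ _).mul (ih hp.pderiv)

theorem reflPt_two_mul (θ : ℝ) (ξ : Plane) (i : Fin 2) :
    reflPt (2 * θ) ξ i = ξ i - 2 * inner ℝ (unitVec θ) ξ * unitVec θ i := by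
  have h := Real.sin_sq_add_cos_sq θ
  fin_cases i
  · simp only [Fin.zero_eta, reflPt_zero, Real.cos_two_mul', Real.sin_two_mul, inner_plane,
      unitVec_zero, unitVec_one]
    linear_combination ξ 0 * h
  · simp only [Fin.mk_one, reflPt_one, Real.cos_two_mul', Real.sin_two_mul, inner_plane,
      unitVec_zero, unitVec_one]
    linear_combination ξ 1 * h

/-- `W ξ` stands for `V (∂_ξ p)` and `q` for `V p`. Applying `T_ξ` to `hq` and exchanging indices by
`symm`, Euler's identity for `W ξ` turns the right side into `c W_ξ - k ∑ sⱼ W_{sⱼξ}` with `c = m +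
1 + γ`. By equivariance the left side is the same expression in `T_ξ q`, so the difference is a
solution of `c Z = k S' Z`. -/
theorem dunklOp_eq_of_smul_sub {n : ℕ} (hn : n ≠ 0) {k : ℂ} (hk : IsRegularParam n k) {m : ℕ}
    {W : Plane → Poly} (hW : ∀ ξ, W ξ = ∑ i, C (ξ i : ℂ) * W (stdVec i))
    (hom : ∀ ξ, (W ξ).IsHomogeneous m)
    (symm : ∀ ξ η, dunklOp n k ξ (W η) = dunklOp n k η (W ξ)) {q : Poly}
    (hq : (((m + 1 : ℕ) : ℂ) + n * k) • q - k • opSum n (reflOp n) q =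
      ∑ i, X i * W (stdVec i)) (ξ : Plane) : dunklOp n k ξ q = W ξ := by
  suffices h : (fun ξ => dunklOp n k ξ q - W ξ) = 0 by
    exact sub_eq_zero.1 (congrFun h ξ)
  refine eq_zero_of_smul_eq_smul_opSum (reflFamOp_add hn) (reflFamOp_triple n) (hk m).1 (hk m).2 ?_
  funext ξ
  have h1 := congrArg (dunklLin n k ξ) hq
  simp only [opSum_apply, map_sub, map_smul, map_sum, dunklLin_apply, dunklOp_reflOp hn,
    dunklOp_X_mul, Finset.sum_add_distrib, ← hW ξ] at h1
  have h2 := sum_X_mul_dunklOp n k (hom ξ)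
  simp only [symm _ ξ] at h2
  rw [h2, Finset.sum_comm] at h1
  -- This is `W_{sξ} = W_ξ - 2⟨α, ξ⟩ W_α`, by linearity in the index. It converts the commutator
  -- terms of `T_ξ` with the coordinates into reflections of the family.
  have h3 : ∀ j : ℕ, W (reflPt (2 * ang n j) ξ) = W ξ -
      ∑ i, C (inner ℝ (unitVec (ang n j)) ξ : ℂ) *
        (C ((2 * unitVec (ang n j) i : ℝ) : ℂ) * W (stdVec i)) := by
    intro j
    rw [hW (reflPt _ ξ), hW ξ, ← Finset.sum_sub_distrib]
    refine Finset.sum_congr rfl fun i _ => ?_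
    rw [reflPt_two_mul]
    simp only [Complex.ofReal_sub, Complex.ofReal_mul, map_sub, map_mul]
    ring
  have h4 : ∀ j : ℕ, ∑ i, C (k * (inner ℝ (unitVec (ang n j)) ξ : ℝ)) *
      (C ((2 * unitVec (ang n j) i : ℝ) : ℂ) * reflOp n j (W (stdVec i))) =
      k • reflOp n j (W ξ) - k • reflOp n j (W (reflPt (2 * ang n j) ξ)) := by
    intro j
    rw [h3, map_sub, smul_sub, sub_sub_cancel, map_sum, Finset.smul_sum]
    refine Finset.sum_congr rfl fun i _ => ?_
    simp only [reflOp_apply, map_mul (reflPoly _), reflPoly_C, smul_eq_C_mul, map_mul]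
    ring
  simp only [h4, Finset.sum_sub_distrib, opSum_apply] at h1
  simp only [Pi.smul_apply, opSum_apply, Finset.sum_apply, reflFamOp_apply, map_sub,
    Finset.sum_sub_distrib, smul_sub]
  rw [← Finset.smul_sum, ← Finset.smul_sum] at h1
  push_cast at h1 ⊢
  linear_combination (norm := module) h1

theorem dunklOp_C (n : ℕ) (k : ℂ) (ξ : Plane) (c : ℂ) : dunklOp n k ξ (C c) = 0 := by
  have h : ∀ θ, divDiff (unitVec θ) (C c) = 0 := fun θ => divDiff_unitVec_eq (by simp)
  simp [dunklOp_eq, dirDeriv_C, h]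

theorem eq_C_of_isHomogeneous_zero {p : Poly} (hp : p.IsHomogeneous 0) : p = C (coeff 0 p) := by
  rw [← homogeneousComponent_zero, homogeneousComponent_eq_self hp]

theorem dirDeriv_comm (ξ η : Plane) (p : Poly) :
    dirDeriv ξ (dirDeriv η p) = dirDeriv η (dirDeriv ξ p) := by
  induction p using MvPolynomial.induction_on with
  | C c => simp [dirDeriv]
  | add p q hp hq => simp only [dirDeriv_add, hp, hq]
  | mul_X p i hp =>
    simp only [dirDeriv_mul, dirDeriv_add, dirDeriv_X, dirDeriv_C, hp]
    ring

/-- The symmetry `T_ξ V ∂_η p = T_η V ∂_ξ p` comes from the induction hypothesis and the commutation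
of ordinary derivatives, so commutativity of the Dunkl operators is not needed. In lowest degree
both sides are `T` of a constant. -/
theorem dunklOp_gradedV {n : ℕ} (hn : n ≠ 0) {k : ℂ} (hk : IsRegularParam n k) (m : ℕ)
    (ξ : Plane) {p : Poly} (hp : p.IsHomogeneous (m + 1)) :
    dunklOp n k ξ (gradedV n k (m + 1) p) = gradedV n k m (dirDeriv ξ p) := by
  induction m generalizing p ξ with
  | zero =>
    refine dunklOp_eq_of_smul_sub hn hk (W := fun ξ => gradedV n k 0 (dirDeriv ξ p)) ?_
      (fun ξ => IsHomogeneous.gradedV n k (IsHomogeneous.dirDeriv hp ξ)) ?_ ?_ ξ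
    · intro ξ
      simp only [dirDeriv_stdVec, gradedV, LinearMap.id_apply]
      rfl
    · intro ξ η
      simp only [gradedV, LinearMap.id_apply]
      rw [eq_C_of_isHomogeneous_zero (IsHomogeneous.dirDeriv hp ξ),
        eq_C_of_isHomogeneous_zero (IsHomogeneous.dirDeriv hp η), dunklOp_C, dunklOp_C]
    · rw [gradedV_succ, smul_resolv_sub (reflOp_add hn) (reflOp_triple n) (hk 0).1 (hk 0).2]
      simp only [dirDeriv_stdVec]
  | succ m ih =>
    refine dunklOp_eq_of_smul_sub hn hk (W := fun ξ => gradedV n k (m + 1) (dirDeriv ξ p)) ?_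
      (fun ξ => IsHomogeneous.gradedV n k (IsHomogeneous.dirDeriv hp ξ)) ?_ ?_ ξ
    · intro ξ
      simp only [dirDeriv_stdVec]
      simp only [dirDeriv, ← smul_eq_C_mul, map_sum, map_smul]
    · intro ξ η
      simp only [ih _ (IsHomogeneous.dirDeriv hp _)]
      rw [dirDeriv_comm]
    · rw [gradedV_succ, smul_resolv_sub (reflOp_add hn) (reflOp_triple n) (hk _).1 (hk _).2]
      simp only [dirDeriv_stdVec]

/-- The intertwining operator as a linear map. -/
def intertwiningMap (n : ℕ) (k : ℂ) : Poly →ₗ[ℂ] Poly :=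
  (basisMonomials (Fin 2) ℂ).constr ℂ fun s => gradedV n k s.degree (monomial s 1)

theorem intertwiningMap_of_isHomogeneous (n : ℕ) (k : ℂ) {m : ℕ} {p : Poly}
    (hp : p.IsHomogeneous m) : intertwiningMap n k p = gradedV n k m p := by
  have h : ∀ s : Fin 2 →₀ ℕ,
      intertwiningMap n k (monomial s 1) = gradedV n k s.degree (monomial s 1) := by
    intro s
    have := (basisMonomials (Fin 2) ℂ).constr_basis ℂ
      (fun s => gradedV n k s.degree (monomial s 1)) s
    rwa [coe_basisMonomials] at this
  rw [p.as_sum, map_sum, map_sum]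
  refine Finset.sum_congr rfl fun s hs => ?_
  have e : (monomial s (coeff s p) : Poly) = coeff s p • monomial s 1 := by
    rw [smul_monomial, smul_eq_mul, mul_one]
  have hd : s.degree = m := by
    by_contra hne
    exact (mem_support_iff.1 hs) (hp.coeff_eq_zero hne)
  rw [e, map_smul, map_smul, h, hd]

theorem dunklOp_intertwiningMap {n : ℕ} (hn : n ≠ 0) {k : ℂ} (hk : IsRegularParam n k)
    (ξ : Plane) (p : Poly) :
    dunklOp n k ξ (intertwiningMap n k p) = intertwiningMap n k (dirDeriv ξ p) := by
  refine poly_induction_homogeneous (P := fun p =>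
    dunklOp n k ξ (intertwiningMap n k p) = intertwiningMap n k (dirDeriv ξ p))
    (fun m p hp => ?_) (fun p q hp hq => ?_) p
  · rw [intertwiningMap_of_isHomogeneous n k hp]
    cases m with
    | zero =>
      rw [eq_C_of_isHomogeneous_zero hp, dirDeriv_C, map_zero]
      exact dunklOp_C _ _ _ _
    | succ m =>
      rw [dunklOp_gradedV hn hk m ξ hp,
        intertwiningMap_of_isHomogeneous n k (IsHomogeneous.dirDeriv hp ξ)]
  · rw [map_add, dirDeriv_add, map_add, ← hp, ← hq]
    exact (dunklLin n k ξ).map_add _ _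

theorem eq_zero_of_pderiv_eq_zero {m : ℕ} {p : Poly} (hp : p.IsHomogeneous (m + 1))
    (h : ∀ i, pderiv i p = 0) : p = 0 := by
  have := hp.sum_X_mul_pderiv
  simp only [h, mul_zero, Finset.sum_const_zero] at this
  exact (smul_eq_zero.1 this.symm).resolve_left (Nat.succ_ne_zero m)

/-- If `V p = 0` then `V ∂ᵢ p = Tᵢ V p = 0`, so by induction every `∂ᵢ p` vanishes, and Euler's
identity gives `p = 0`. -/
theorem eq_zero_of_gradedV_eq_zero {n : ℕ} (hn : n ≠ 0) {k : ℂ} (hk : IsRegularParam n k) {m : ℕ}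
    {p : Poly} (hp : p.IsHomogeneous m) (h : gradedV n k m p = 0) : p = 0 := by
  induction m generalizing p with
  | zero => exact h
  | succ m ih =>
    refine eq_zero_of_pderiv_eq_zero hp fun i => ih hp.pderiv ?_
    have := dunklOp_gradedV hn hk m (stdVec i) hp
    rw [h, dirDeriv_stdVec] at this
    rw [← this]
    exact (dunklLin n k _).map_zero

theorem homogeneousComponent_intertwiningMap (n : ℕ) (k : ℂ) (m : ℕ) (p : Poly) :
    homogeneousComponent m (intertwiningMap n k p) =
      intertwiningMap n k (homogeneousComponent m p) := by
  refine poly_induction_homogeneous (P := fun p => homogeneousComponent m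
    (intertwiningMap n k p) = intertwiningMap n k (homogeneousComponent m p))
    (fun i p hp => ?_) (fun p q hp hq => ?_) p
  · have h := IsHomogeneous.gradedV n k hp
    rw [← intertwiningMap_of_isHomogeneous n k hp] at h
    rw [homogeneousComponent_of_mem h, homogeneousComponent_of_mem hp]
    split_ifs <;> simp
  · simp only [map_add, hp, hq]

theorem intertwiningMap_injective {n : ℕ} (hn : n ≠ 0) {k : ℂ} (hk : IsRegularParam n k) :
    Function.Injective (intertwiningMap n k) := by
  rw [injective_iff_map_eq_zero]
  intro p hp
  rw [← sum_homogeneousComponent p]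
  refine Finset.sum_eq_zero fun m _ => ?_
  have hm := homogeneousComponent_isHomogeneous m p
  refine eq_zero_of_gradedV_eq_zero hn hk hm ?_
  rw [← intertwiningMap_of_isHomogeneous n k hm, ← homogeneousComponent_intertwiningMap, hp,
    map_zero]

theorem intertwiningMap_surjective {n : ℕ} (hn : n ≠ 0) {k : ℂ} (hk : IsRegularParam n k) :
    Function.Surjective (intertwiningMap n k) := by
  rw [← LinearMap.range_eq_top, eq_top_iff]
  rintro q -
  refine poly_induction_homogeneous (P := (· ∈ LinearMap.range (intertwiningMap n k)))
    (fun m q hq => ?_) (fun p q hp hq => Submodule.add_mem _ hp hq) q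
  -- Each homogeneous piece is finite-dimensional and stable, so injectivity there gives
  -- surjectivity.
  have : Module.Finite ℂ (homogeneousSubmodule (Fin 2) ℂ m) :=
    Module.Finite.iff_fg.2 (homogeneousSubmodule_fg (Fin 2) ℂ m)
  have hmap : ∀ p ∈ homogeneousSubmodule (Fin 2) ℂ m,
      intertwiningMap n k p ∈ homogeneousSubmodule (Fin 2) ℂ m := by
    intro p hp
    rw [intertwiningMap_of_isHomogeneous n k hp]
    exact IsHomogeneous.gradedV n k hp
  have hinj : Function.Injective ((intertwiningMap n k).restrict hmap) := by
    intro a b hab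
    exact Subtype.ext (intertwiningMap_injective hn hk (congrArg Subtype.val hab))
  obtain ⟨p, hp⟩ := LinearMap.injective_iff_surjective.1 hinj ⟨q, hq⟩
  exact ⟨p, congrArg Subtype.val hp⟩

theorem exists_isIntertwining {n : ℕ} (hn : n ≠ 0) {k : ℂ} (hk : IsRegularParam n k) :
    ∃ V, IsIntertwining n k V := by
  have hbij : Function.Bijective (intertwiningMap n k) :=
    ⟨intertwiningMap_injective hn hk, intertwiningMap_surjective hn hk⟩
  refine ⟨LinearEquiv.ofBijective (intertwiningMap n k) hbij, ?_, ?_, ?_⟩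
  · intro m p hp
    rw [LinearEquiv.ofBijective_apply, intertwiningMap_of_isHomogeneous n k hp]
    exact IsHomogeneous.gradedV n k hp
  · rw [LinearEquiv.ofBijective_apply,
      intertwiningMap_of_isHomogeneous n k (isHomogeneous_one _ _)]
    rfl
  · exact dunklOp_intertwiningMap hn hk

theorem IsIntertwining.smul_sub_smul {n : ℕ} {k : ℂ} {V : Poly ≃ₗ[ℂ] Poly} (hV : IsIntertwining n k V)
    {m : ℕ} {p : Poly} (hp : p.IsHomogeneous m) :
    ((m : ℂ) + n * k) • V p - k • opSum n (reflOp n) (V p) = ∑ i, X i * V (pderiv i p) := by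
  rw [← sum_X_mul_dunklOp n k (hV.homogeneous m p hp)]
  simp only [hV.intertwines, dirDeriv_stdVec]

theorem IsIntertwining.unique {n : ℕ} (hn : n ≠ 0) {k : ℂ} (hk : IsRegularParam n k)
    {V V' : Poly ≃ₗ[ℂ] Poly} (hV : IsIntertwining n k V) (hV' : IsIntertwining n k V') :
    V = V' := by
  have h : ∀ m p, p.IsHomogeneous m → V p = V' p := by
    intro m
    induction m with
    | zero =>
      intro p hp
      rw [eq_C_of_isHomogeneous_zero hp, ← mul_one (C (coeff 0 p)), ← smul_eq_C_mul, map_smul,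
        map_smul, hV.map_one, hV'.map_one]
    | succ m ih =>
      intro p hp
      have h1 := hV.smul_sub_smul hp
      have h2 := hV'.smul_sub_smul hp
      simp only [ih _ hp.pderiv] at h1
      rw [← h2] at h1
      refine sub_eq_zero.1 (eq_zero_of_smul_eq_smul_opSum (reflOp_add hn) (reflOp_triple n)
        (hk m).1 (hk m).2 (k := k) ?_)
      rw [smul_sub, map_sub, smul_sub]
      linear_combination (norm := module) h1
  ext1 p
  exact poly_induction_homogeneous h (fun p q hp hq => by rw [map_add, map_add, hp, hq]) p

theorem existsUnique_isIntertwining {n : ℕ} (hn : n ≠ 0) {k : ℂ} (hk : IsRegularParam n k) :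
    ∃! V, IsIntertwining n k V := by
  obtain ⟨V, hV⟩ := exists_isIntertwining hn hk
  exact ⟨V, hV, fun V' hV' => hV'.unique hn hk hV⟩

/-! ### The recursion for the homogeneous components of the Dunkl kernel -/

theorem dunklE_zero {n : ℕ} (hn : n ≠ 0) {k : ℂ} (hk : IsRegularParam n k) (x y : Plane) :
    dunklE n k 0 x y = 1 := by
  have hV : IsIntertwining n k (intertwiner n k) :=
    Classical.epsilon_spec (exists_isIntertwining hn hk)
  simp [dunklE, hV.map_one, evalAt]

/-- Euler's identity for `V (⟨·, y⟩ ^ (m + 1))`, evaluated at `x` and divided by `(m + 1)!`; the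
derivatives `∂ᵢ` produce the factors `yᵢ` that assemble into `⟨x, y⟩`. -/
theorem dunklE_succ {n : ℕ} (hn : n ≠ 0) {k : ℂ} (hk : IsRegularParam n k) (m : ℕ)
    (x y : Plane) :
    ((m : ℂ) + 1 + n * k) * dunklE n k (m + 1) x y -
        k * ∑ j ∈ Finset.range n, dunklE n k (m + 1) (reflPt (2 * ang n j) x) y =
      (inner ℝ x y : ℝ) * dunklE n k m x y := by
  have hV : IsIntertwining n k (intertwiner n k) :=
    Classical.epsilon_spec (exists_isIntertwining hn hk)
  have hlin : (linForm y).IsHomogeneous 1 := by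
    rw [linForm_eq]
    exact (isHomogeneous_C_mul_X _ _).add (isHomogeneous_C_mul_X _ _)
  have hp : (linForm y ^ (m + 1)).IsHomogeneous (m + 1) := by
    simpa using hlin.pow (m + 1)
  have hd : ∀ i, pderiv i (linForm y ^ (m + 1)) =
      (((m : ℂ) + 1) * (y i : ℂ)) • linForm y ^ m := by
    intro i
    have h1 : pderiv i (linForm y) = C (y i : ℂ) := by
      rw [← dirDeriv_stdVec, linForm_eq, dirDeriv_add, dirDeriv_mul, dirDeriv_mul, dirDeriv_C,
        dirDeriv_C, dirDeriv_X, dirDeriv_X]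
      fin_cases i <;> simp
    rw [pderiv_pow, h1, smul_eq_C_mul]
    simp
    ring
  have h := congrArg (evalAt x) (hV.smul_sub_smul hp)
  simp only [hd, map_smul, opSum_apply, evalAt, map_sub, map_sum, smul_eval, map_mul,
    eval_X] at h
  have hev : ∀ j : ℕ, eval (fun i => (x i : ℂ)) (reflOp n j
      (intertwiner n k (linForm y ^ (m + 1)))) =
      evalAt (reflPt (2 * ang n j) x) (intertwiner n k (linForm y ^ (m + 1))) := by
    intro j
    rw [← evalAt_reflPoly]
    rfl
  simp only [hev, Fin.sum_univ_two] at h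
  have hf : (((m + 1).factorial : ℕ) : ℂ) = ((m : ℂ) + 1) * (m.factorial : ℂ) := by
    rw [Nat.factorial_succ]; push_cast; ring
  have h0 : (m.factorial : ℂ) ≠ 0 := Nat.cast_ne_zero.2 m.factorial_ne_zero
  have h1 : (m : ℂ) + 1 ≠ 0 := Nat.cast_add_one_ne_zero m
  simp only [dunklE, ← Finset.mul_sum, hf, inner_plane]
  simp only [evalAt] at h ⊢
  push_cast at h ⊢
  field_simp
  linear_combination h

/-! ### The vectors `A_p` in terms of the Dunkl kernel -/

theorem rot_eq (n j : ℕ) (x : Plane) : rot n j x = rotPt (2 * ang n j) x := by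
  have e : 2 * ang n j = 2 * Real.pi * j / n := by simp only [ang]; push_cast; ring
  rw [e]
  rfl

theorem rot_sigma_eq (n j : ℕ) (x : Plane) : rot n j (sigma x) = reflPt (2 * ang n j) x := by
  have e : 2 * ang n j = 2 * Real.pi * j / n := by simp only [ang]; push_cast; ring
  rw [e]
  apply plane_ext
  · simp [rot, sigma]
  · simp [rot, sigma, sub_eq_add_neg]

theorem rot_zero (n : ℕ) (x : Plane) : rot n 0 x = x := by
  apply plane_ext <;> simp [rot]

/-- The sum of `⟨r ^ i x, y⟩ ^ q` over all rotations. -/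
def rotPow (n : ℕ) (x y : Plane) (q : ℕ) : ℂ :=
  ∑ i ∈ Finset.range n, ((inner ℝ (rot n i x) y : ℝ) : ℂ) ^ q

/-- The sum of `⟨r ^ i σ x, y⟩ ^ q` over all reflections. -/
def reflPow (n : ℕ) (x y : Plane) (q : ℕ) : ℂ :=
  ∑ i ∈ Finset.range n, ((inner ℝ (rot n i (sigma x)) y : ℝ) : ℂ) ^ q

theorem coeffB_eq (n : ℕ) (k : ℂ) (x y : Plane) (q : ℕ) :
    coeffB n k x y q = (gam n k / (2 * n)) •
      !![rotPow n x y (q + 1) + reflPow n x y (q + 1),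
          -(rotPow n x y (q + 1) - reflPow n x y (q + 1));
        rotPow n x y (q + 1) - reflPow n x y (q + 1),
          -(rotPow n x y (q + 1) + reflPow n x y (q + 1))] := by
  rw [coeffB]
  congr 1
  ext a b
  rw [Matrix.sum_apply]
  fin_cases a <;> fin_cases b <;>
    simp [rotPow, reflPow, Finset.sum_add_distrib, Finset.sum_sub_distrib]

theorem coeffA_zero (n : ℕ) (k : ℂ) (x y : Plane) :
    coeffA n k x y 0 = ![2 * n / gam n k, 0] := by
  rw [coeffA]

theorem coeffA_succ_zero (n : ℕ) (k : ℂ) (x y : Plane) (p : ℕ) :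
    coeffA n k x y (p + 1) 0 = 1 / ((p : ℂ) + 1) * (gam n k / (2 * n) *
      ∑ i ∈ Finset.range (p + 1),
        (rotPow n x y (p - i + 1) * (coeffA n k x y i 0 - coeffA n k x y i 1) +
          reflPow n x y (p - i + 1) * (coeffA n k x y i 0 + coeffA n k x y i 1))) := by
  rw [coeffA, Finset.sum_range, Finset.mul_sum]
  simp only [Matrix.mulVec, dotProduct, Fin.sum_univ_two, coeffB_eq, Finset.sum_apply, Matrix.smul_apply, Matrix.of_apply, Matrix.cons_val', smul_eq_mul,
    Matrix.cons_val_zero, Matrix.cons_val_one, Matrix.cons_val_fin_one, zero_mul, add_zero]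
  congr 1
  exact Finset.sum_congr rfl fun i _ => by ring

theorem coeffA_succ_one (n : ℕ) (k : ℂ) (x y : Plane) (p : ℕ) :
    coeffA n k x y (p + 1) 1 = 1 / ((p : ℂ) + 1 + 2 * gam n k) * (gam n k / (2 * n) *
      ∑ i ∈ Finset.range (p + 1),
        (rotPow n x y (p - i + 1) * (coeffA n k x y i 0 - coeffA n k x y i 1) -
          reflPow n x y (p - i + 1) * (coeffA n k x y i 0 + coeffA n k x y i 1))) := by
  rw [coeffA, Finset.sum_range, Finset.mul_sum]
  simp only [Matrix.mulVec, dotProduct, Fin.sum_univ_two, coeffB_eq, Finset.sum_apply, Matrix.smul_apply, Matrix.of_apply, Matrix.cons_val', smul_eq_mul,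
    Matrix.cons_val_zero, Matrix.cons_val_one, Matrix.cons_val_fin_one, zero_mul, zero_add]
  congr 1
  exact Finset.sum_congr rfl fun i _ => by ring

theorem poch_succ (c : ℂ) (m : ℕ) : poch c (m + 1) = poch c m * (c + m) := by
  rw [poch, poch, Finset.prod_range_succ]

theorem poch_succ' (c : ℂ) (m : ℕ) : poch c (m + 1) = c * poch (1 + c) m := by
  rw [poch, poch, Finset.prod_range_succ', mul_comm]
  congr 1
  · simp
  · exact Finset.prod_congr rfl fun i _ => by push_cast; ring

theorem poch_zero (c : ℂ) : poch c 0 = 1 := by simp [poch]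

/-- With the reflection sums `M` treated as data, `dunklE_succ` is a first-order linear recursion.
The integrating factor is `(1 + γ)_m`, and `k (1 + γ)_m = (γ)_{m+1} / n`. The solution is implicit,
since `M m` still contains kernels of degree `m`. -/
theorem poch_mul_dunklE {n : ℕ} (hn : n ≠ 0) {k : ℂ} (hk : IsRegularParam n k) {x y : Plane}
    {M : ℕ → ℂ}
    (hM : ∀ m, ∑ j ∈ Finset.range n, dunklE n k m (reflPt (2 * ang n j) x) y = M m) (m : ℕ) :
    poch (1 + gam n k) m * dunklE n k m x y = ∑ i ∈ Finset.range (m + 1),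
      ((inner ℝ x y : ℝ) : ℂ) ^ (m - i) * (poch (gam n k) i * M i / n) := by
  have hn' : (n : ℂ) ≠ 0 := Nat.cast_ne_zero.2 hn
  induction m with
  | zero =>
    have : M 0 = n := by
      rw [← hM 0]
      simp [dunklE_zero hn hk]
    simp [poch_zero, dunklE_zero hn hk, this, hn']
  | succ m ih =>
    have h := dunklE_succ hn hk m x y
    rw [hM] at h
    have e : ∑ i ∈ Finset.range (m + 1),
        ((inner ℝ x y : ℝ) : ℂ) ^ (m + 1 - i) * (poch (gam n k) i * M i / n) =
        (inner ℝ x y : ℝ) * ∑ i ∈ Finset.range (m + 1),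
        ((inner ℝ x y : ℝ) : ℂ) ^ (m - i) * (poch (gam n k) i * M i / n) := by
      rw [Finset.mul_sum]
      refine Finset.sum_congr rfl fun i hi => ?_
      rw [Nat.succ_sub (Finset.mem_range_succ_iff.1 hi), pow_succ]
      ring
    rw [Finset.sum_range_succ, e, ← ih, poch_succ, poch_succ', Nat.sub_self, pow_zero, one_mul,
      gam]
    field_simp
    linear_combination poch (1 + n * k) m * h

/-- The sum of `E_m(r ^ i x, y)` over all rotations. -/
def rotE (n : ℕ) (k : ℂ) (x y : Plane) (m : ℕ) : ℂ :=
  ∑ j ∈ Finset.range n, dunklE n k m (rotPt (2 * ang n j) x) y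

/-- The sum of `E_m(r ^ i σ x, y)` over all reflections. -/
def reflE (n : ℕ) (k : ℂ) (x y : Plane) (m : ℕ) : ℂ :=
  ∑ j ∈ Finset.range n, dunklE n k m (reflPt (2 * ang n j) x) y

theorem sum_dunklE_reflPt_rotPt {n : ℕ} (hn : n ≠ 0) (k : ℂ) (x y : Plane) (a : ℤ) (m : ℕ) :
    ∑ j ∈ Finset.range n, dunklE n k m (reflPt (2 * ang n j) (rotPt (2 * ang n a) x)) y =
      reflE n k x y m := by
  rw [reflE, ← sum_range_add_of_periodic
    (F := fun j : ℤ => dunklE n k m (reflPt (2 * ang n j) x) y)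
    (fun j => by simp only [reflPt_ang_add hn]) (-a)]
  refine Finset.sum_congr rfl fun j _ => ?_
  rw [reflPt_rotPt, ← sub_eq_add_neg, ang_sub, mul_sub]

theorem sum_dunklE_reflPt_reflPt {n : ℕ} (hn : n ≠ 0) (k : ℂ) (x y : Plane) (a : ℤ) (m : ℕ) :
    ∑ j ∈ Finset.range n, dunklE n k m (reflPt (2 * ang n j) (reflPt (2 * ang n a) x)) y =
      rotE n k x y m := by
  rw [rotE, ← sum_range_add_of_periodic
    (F := fun j : ℤ => dunklE n k m (rotPt (2 * ang n j) x) y)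
    (fun j => by simp only [rotPt_ang_add hn]) (-a)]
  refine Finset.sum_congr rfl fun j _ => ?_
  rw [reflPt_reflPt, ← sub_eq_add_neg, ang_sub, mul_sub]

/-- At every point of the rotation orbit of `x` the reflection sum is the same `reflE`, so only the
powers of the pairing get summed. On the other coset the roles of `rotE` and `reflE` are exchanged.
-/
theorem poch_mul_rotE {n : ℕ} (hn : n ≠ 0) {k : ℂ} (hk : IsRegularParam n k) (x y : Plane)
    (m : ℕ) : poch (1 + gam n k) m * rotE n k x y m = ∑ i ∈ Finset.range (m + 1),
      rotPow n x y (m - i) * (poch (gam n k) i * reflE n k x y i / n) := by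
  rw [rotE, Finset.mul_sum]
  simp only [fun j : ℕ => poch_mul_dunklE hn hk (y := y) (sum_dunklE_reflPt_rotPt hn k x y j) m]
  rw [Finset.sum_comm]
  simp only [rotPow, Finset.sum_mul, rot_eq]

theorem poch_mul_reflE {n : ℕ} (hn : n ≠ 0) {k : ℂ} (hk : IsRegularParam n k) (x y : Plane)
    (m : ℕ) : poch (1 + gam n k) m * reflE n k x y m = ∑ i ∈ Finset.range (m + 1),
      reflPow n x y (m - i) * (poch (gam n k) i * rotE n k x y i / n) := by
  rw [reflE, Finset.mul_sum]
  simp only [fun j : ℕ => poch_mul_dunklE hn hk (y := y) (sum_dunklE_reflPt_reflPt hn k x y j) m]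
  rw [Finset.sum_comm]
  simp only [reflPow, Finset.sum_mul, rot_sigma_eq]

theorem coeffA_eq {n : ℕ} (hn : n ≠ 0) {k : ℂ} (hk : ∀ m : ℕ, gam n k ≠ -(m : ℂ) / 2)
    (x y : Plane) (p : ℕ) :
    coeffA n k x y p 0 = poch (gam n k) p * (rotE n k x y p + reflE n k x y p) / gam n k ∧
    coeffA n k x y p 1 = poch (gam n k) p * (rotE n k x y p - reflE n k x y p) / gam n k := by
  have hk' := isRegularParam_of_gam_ne hk
  have hn' : (n : ℂ) ≠ 0 := Nat.cast_ne_zero.2 hn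
  have hg : gam n k ≠ 0 := by simpa using hk 0
  induction p using Nat.strong_induction_on with
  | _ p ih =>
    cases p with
    | zero =>
      simp [coeffA_zero, rotE, reflE, dunklE_zero hn hk', poch_zero]
      ring
    | succ p =>
      have h1 := poch_mul_rotE hn hk' x y (p + 1)
      have h2 := poch_mul_reflE hn hk' x y (p + 1)
      -- The top terms carry the unknowns of degree `p + 1`. Moving them to the left, the sum of the
      -- two equations has factor `p + 1` and their difference has factor `p + 1 + 2γ`, the
      -- denominators in the recursion for `A`.
      rw [Finset.sum_range_succ, poch_succ, poch_succ'] at h1 h2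
      have s1 : ∀ F G : ℕ → ℂ, ∑ i ∈ Finset.range (p + 1), F (p + 1 - i) * G i =
          ∑ i ∈ Finset.range (p + 1), F (p - i + 1) * G i := fun F G =>
        Finset.sum_congr rfl fun i hi => by rw [Nat.succ_sub (Finset.mem_range_succ_iff.1 hi)]
      rw [s1] at h1 h2
      have hr0 : rotPow n x y 0 = n := by simp [rotPow]
      have hr1 : reflPow n x y 0 = n := by simp [reflPow]
      rw [Nat.sub_self, hr0] at h1
      rw [Nat.sub_self, hr1] at h2
      set SU := ∑ i ∈ Finset.range (p + 1),
        rotPow n x y (p - i + 1) * (poch (gam n k) i * reflE n k x y i / n) with hSU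
      set SV := ∑ i ∈ Finset.range (p + 1),
        reflPow n x y (p - i + 1) * (poch (gam n k) i * rotE n k x y i / n) with hSV
      have hU : gam n k / (2 * n) * ∑ i ∈ Finset.range (p + 1), rotPow n x y (p - i + 1) *
          (coeffA n k x y i 0 - coeffA n k x y i 1) = SU := by
        rw [hSU, Finset.mul_sum]
        refine Finset.sum_congr rfl fun i hi => ?_
        rw [(ih i (Finset.mem_range.1 hi)).1, (ih i (Finset.mem_range.1 hi)).2]
        field_simp
        ring
      have hV : gam n k / (2 * n) * ∑ i ∈ Finset.range (p + 1), reflPow n x y (p - i + 1) *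
          (coeffA n k x y i 0 + coeffA n k x y i 1) = SV := by
        rw [hSV, Finset.mul_sum]
        refine Finset.sum_congr rfl fun i hi => ?_
        rw [(ih i (Finset.mem_range.1 hi)).1, (ih i (Finset.mem_range.1 hi)).2]
        field_simp
        ring
      have hp1 : (p : ℂ) + 1 ≠ 0 := Nat.cast_add_one_ne_zero p
      have hp2 : (p : ℂ) + 1 + 2 * gam n k ≠ 0 := by
        intro h
        refine hk (p + 1) ?_
        push_cast
        linear_combination h / 2
      rw [mul_div_cancel₀ _ hn'] at h1 h2
      constructor
      · rw [coeffA_succ_zero, Finset.sum_add_distrib, mul_add, hU, hV, poch_succ']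
        field_simp
        linear_combination -h1 - h2
      · rw [coeffA_succ_one, Finset.sum_sub_distrib, mul_sub, hU, hV, poch_succ']
        field_simp
        linear_combination -h1 + h2

theorem poch_mul_dunklE_eq {n : ℕ} (hn : n ≠ 0) {k : ℂ} (hk : ∀ m : ℕ, gam n k ≠ -(m : ℂ) / 2)
    (x y : Plane) (m : ℕ) :
    2 * n / gam n k * (poch (1 + gam n k) m * dunklE n k m x y) =
      ∑ i ∈ Finset.range (m + 1), ((inner ℝ x y : ℝ) : ℂ) ^ (m - i) *
        (coeffA n k x y i 0 - coeffA n k x y i 1) := by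
  have hn' : (n : ℂ) ≠ 0 := Nat.cast_ne_zero.2 hn
  have hg : gam n k ≠ 0 := by simpa using hk 0
  rw [poch_mul_dunklE hn (isRegularParam_of_gam_ne hk) (M := reflE n k x y) (fun _ => rfl),
    Finset.mul_sum]
  refine Finset.sum_congr rfl fun i _ => ?_
  rw [(coeffA_eq hn hk x y i).1, (coeffA_eq hn hk x y i).2]
  field_simp
  ring

theorem poch_one_add_gam_ne_zero {n : ℕ} {k : ℂ} (hk : ∀ m : ℕ, gam n k ≠ -(m : ℂ) / 2) (m : ℕ) :
    poch (1 + gam n k) m ≠ 0 := by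
  refine Finset.prod_ne_zero_iff.2 fun j _ h => hk (2 * (j + 1)) ?_
  push_cast
  linear_combination h

end Algebra

/-! ### Analysis: convergence, the differential system and the integral formula. -/

section Analysis

open Filter Topology

/-! ### Bounds for the vectors `A_p` -/

theorem abs_inner_rot_le_maxPairing {n j : ℕ} (hj : j < n) (x y : Plane) :
    |inner ℝ (rot n j x) y| ≤ maxPairing n x y ∧
      |inner ℝ (rot n j (sigma x)) y| ≤ maxPairing n x y := by
  have h := le_ciSup (f := fun j : Fin n =>
    max |inner ℝ (rot n j x) y| |inner ℝ (rot n j (sigma x)) y|)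
    (Set.finite_range _).bddAbove ⟨j, hj⟩
  exact ⟨(le_max_left _ _).trans h, (le_max_right _ _).trans h⟩

theorem maxPairing_nonneg {n : ℕ} (hn : n ≠ 0) (x y : Plane) : 0 ≤ maxPairing n x y :=
  (abs_nonneg _).trans (abs_inner_rot_le_maxPairing (Nat.pos_of_ne_zero hn) x y).1

theorem norm_rotPow_le (n : ℕ) (x y : Plane) (q : ℕ) :
    ‖rotPow n x y q‖ ≤ n * maxPairing n x y ^ q := by
  refine (norm_sum_le_of_le _ (fun i hi => ?_)).trans_eq
    (by rw [Finset.sum_const, Finset.card_range, nsmul_eq_mul])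
  rw [norm_pow, Complex.norm_real]
  exact pow_le_pow_left₀ (norm_nonneg _)
    (abs_inner_rot_le_maxPairing (Finset.mem_range.1 hi) x y).1 q

theorem norm_reflPow_le (n : ℕ) (x y : Plane) (q : ℕ) :
    ‖reflPow n x y q‖ ≤ n * maxPairing n x y ^ q := by
  refine (norm_sum_le_of_le _ (fun i hi => ?_)).trans_eq
    (by rw [Finset.sum_const, Finset.card_range, nsmul_eq_mul])
  rw [norm_pow, Complex.norm_real]
  exact pow_le_pow_left₀ (norm_nonneg _)
    (abs_inner_rot_le_maxPairing (Finset.mem_range.1 hi) x y).2 q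

/-- For `p ≥ ‖c‖` the denominator has norm at least `1`; the finitely many other values are absorbed
into the constant. A zero denominator is harmless, since `1 / 0 = 0`. -/
theorem exists_norm_one_div_le (c : ℂ) :
    ∃ K : ℝ, 1 ≤ K ∧ ∀ p : ℕ, ‖1 / ((p : ℂ) + 1 + c)‖ ≤ K := by
  refine ⟨1 + ∑ p ∈ Finset.range ⌈‖c‖⌉₊, ‖1 / ((p : ℂ) + 1 + c)‖, ?_, fun p => ?_⟩
  · have : 0 ≤ ∑ p ∈ Finset.range ⌈‖c‖⌉₊, ‖1 / ((p : ℂ) + 1 + c)‖ :=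
      Finset.sum_nonneg fun _ _ => norm_nonneg _
    linarith
  · rcases lt_or_ge p ⌈‖c‖⌉₊ with hp | hp
    · have := Finset.single_le_sum (f := fun p : ℕ => ‖1 / ((p : ℂ) + 1 + c)‖)
        (fun _ _ => norm_nonneg _) (Finset.mem_range.2 hp)
      linarith
    · have h1 : ‖c‖ ≤ p := (Nat.le_ceil _).trans (by exact_mod_cast hp)
      have h2 : (1 : ℝ) ≤ ‖(p : ℂ) + 1 + c‖ := by
        have h3 := norm_sub_le ((p : ℂ) + 1 + c) c
        rw [add_sub_cancel_right] at h3
        have h4 : ‖(p : ℂ) + 1‖ = p + 1 := by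
          exact_mod_cast Complex.norm_natCast (p + 1)
        linarith
      have h5 : ‖1 / ((p : ℂ) + 1 + c)‖ ≤ 1 := by
        rw [norm_div, norm_one]
        exact div_le_one_of_le₀ h2 (norm_nonneg _)
      have : 0 ≤ ∑ p ∈ Finset.range ⌈‖c‖⌉₊, ‖1 / ((p : ℂ) + 1 + c)‖ :=
        Finset.sum_nonneg fun _ _ => norm_nonneg _
      linarith

/-- Induction against the majorant `M (1 + L)^p a^p` with `L = 2K‖γ‖`. The recursion bounds the next
term by `L` times a geometric sum of ratio `1 + L`, which telescopes to `(1 + L)^(p+1) - 1`. -/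
theorem norm_coeffA_le {n : ℕ} (hn : n ≠ 0) {k : ℂ} {K : ℝ} (hK : 0 ≤ K)
    (h1 : ∀ p : ℕ, ‖1 / ((p : ℂ) + 1)‖ ≤ K)
    (h2 : ∀ p : ℕ, ‖1 / ((p : ℂ) + 1 + 2 * gam n k)‖ ≤ K) (x y : Plane) (p : ℕ) (j : Fin 2) :
    ‖coeffA n k x y p j‖ ≤ ‖2 * n / gam n k‖ *
      ((1 + 2 * K * ‖gam n k‖) * maxPairing n x y) ^ p := by
  have hn' : (n : ℝ) ≠ 0 := Nat.cast_ne_zero.2 hn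
  set a := maxPairing n x y with ha
  have ha0 : 0 ≤ a := maxPairing_nonneg hn x y
  set L := 2 * K * ‖gam n k‖ with hL
  have hL0 : 0 ≤ L := by positivity
  set M := ‖2 * n / gam n k‖
  have hM0 : 0 ≤ M := norm_nonneg _
  induction p using Nat.strong_induction_on generalizing j with
  | _ p ih =>
    cases p with
    | zero =>
      rw [coeffA_zero, pow_zero, mul_one]
      fin_cases j
      · exact le_rfl
      · simpa using hM0
    | succ p =>
      have hterm : ∀ i ∈ Finset.range (p + 1),
          ‖rotPow n x y (p - i + 1) * (coeffA n k x y i 0 - coeffA n k x y i 1)‖ +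
          ‖reflPow n x y (p - i + 1) * (coeffA n k x y i 0 + coeffA n k x y i 1)‖ ≤
          4 * n * M * (a ^ (p + 1) * (1 + L) ^ i) := by
        intro i hi
        have hi' := Finset.mem_range.1 hi
        have b0 := ih i hi' 0
        have b1 := ih i hi' 1
        have hs := norm_sub_le (coeffA n k x y i 0) (coeffA n k x y i 1)
        have hp := norm_add_le (coeffA n k x y i 0) (coeffA n k x y i 1)
        have e : a ^ (p + 1) = a ^ (p - i + 1) * a ^ i := by
          rw [← pow_add]; congr 1; omega
        rw [norm_mul, norm_mul]
        calc _ ≤ n * a ^ (p - i + 1) * (2 * (M * ((1 + L) * a) ^ i)) +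
              n * a ^ (p - i + 1) * (2 * (M * ((1 + L) * a) ^ i)) := by
              gcongr
              · exact norm_rotPow_le n x y _
              · linarith
              · exact norm_reflPow_le n x y _
              · linarith
          _ = _ := by rw [e, mul_pow]; ring
      have hsum : K * (‖gam n k / (2 * n)‖ * ∑ i ∈ Finset.range (p + 1),
          (‖rotPow n x y (p - i + 1) * (coeffA n k x y i 0 - coeffA n k x y i 1)‖ +
          ‖reflPow n x y (p - i + 1) * (coeffA n k x y i 0 + coeffA n k x y i 1)‖)) ≤
          M * ((1 + L) * a) ^ (p + 1) := by
        calc _ ≤ K * (‖gam n k / (2 * n)‖ * ∑ i ∈ Finset.range (p + 1),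
                4 * n * M * (a ^ (p + 1) * (1 + L) ^ i)) := by
              gcongr with i hi
              exact hterm i hi
          _ = M * a ^ (p + 1) * ((∑ i ∈ Finset.range (p + 1), (1 + L) ^ i) * (1 + L - 1)) := by
              rw [← Finset.mul_sum, ← Finset.mul_sum, norm_div, norm_mul, Complex.norm_natCast,
                Complex.norm_ofNat, hL]
              field_simp
              ring
          _ = M * a ^ (p + 1) * ((1 + L) ^ (p + 1) - 1) := by rw [geom_sum_mul]
          _ ≤ M * a ^ (p + 1) * (1 + L) ^ (p + 1) := by
              gcongr
              linarith
          _ = _ := by rw [mul_pow]; ring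
      refine le_trans ?_ hsum
      fin_cases j
      · change ‖coeffA n k x y (p + 1) 0‖ ≤ _
        rw [coeffA_succ_zero, norm_mul _ (_ * _), norm_mul (gam n k / (2 * n))]
        refine mul_le_mul (h1 p) (mul_le_mul_of_nonneg_left ?_ (norm_nonneg _)) (by positivity) hK
        exact norm_sum_le_of_le _ fun i _ => norm_add_le _ _
      · change ‖coeffA n k x y (p + 1) 1‖ ≤ _
        rw [coeffA_succ_one, norm_mul _ (_ * _), norm_mul (gam n k / (2 * n))]
        refine mul_le_mul (h2 p) (mul_le_mul_of_nonneg_left ?_ (norm_nonneg _)) (by positivity) hK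
        exact norm_sum_le_of_le _ fun i _ => norm_sub_le _ _

/-- There is a constant depending only on `n` and `k` that controls the growth of all the
vectors `A_p`. -/
theorem exists_growth_bound {n : ℕ} (hn : n ≠ 0) (k : ℂ) : ∃ δ : ℝ, 1 ≤ δ ∧ ∀ x y : Plane,
    ∀ (p : ℕ) (j : Fin 2),
      ‖coeffA n k x y p j‖ ≤ ‖2 * n / gam n k‖ * (δ * maxPairing n x y) ^ p := by
  obtain ⟨K₁, hK₁, h₁⟩ := exists_norm_one_div_le 0
  obtain ⟨K₂, hK₂, h₂⟩ := exists_norm_one_div_le (2 * gam n k)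
  have hK : 0 ≤ max K₁ K₂ := le_max_of_le_left (by linarith)
  refine ⟨1 + 2 * max K₁ K₂ * ‖gam n k‖, le_add_of_nonneg_right (by positivity), fun x y =>
    norm_coeffA_le hn hK (fun p => ?_) (fun p => (h₂ p).trans (le_max_right _ _)) x y⟩
  simpa using (h₁ p).trans (le_max_left _ _)

/-! ### Power series -/

theorem _root_.HasSum.congr_terms {f g : ℕ → ℂ} {S : ℂ} (h : HasSum g S) (e : ∀ p, f p = g p) :
    HasSum f S := by
  rwa [funext e]

theorem hasSum_geometric_mul {s : ℕ → ℂ} {z t : ℂ} (hs : Summable fun i => ‖s i * z ^ i‖)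
    (ht : ‖z * t‖ < 1) :
    HasSum (fun p => z ^ p * ∑ i ∈ Finset.range (p + 1), t ^ (p - i) * s i)
      ((∑' i, s i * z ^ i) / (1 - z * t)) := by
  have h := hasSum_sum_range_mul_of_summable_norm hs (summable_norm_geometric_of_norm_lt_one ht)
  rw [tsum_geometric_of_norm_lt_one ht, ← div_eq_mul_inv] at h
  have e : (fun p => z ^ p * ∑ i ∈ Finset.range (p + 1), t ^ (p - i) * s i) =
      fun p => ∑ i ∈ Finset.range (p + 1), s i * z ^ i * (z * t) ^ (p - i) := by
    funext p
    rw [Finset.mul_sum]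
    refine Finset.sum_congr rfl fun i hi => ?_
    rw [← pow_mul_pow_sub z (Finset.mem_range_succ_iff.1 hi)]
    ring
  rwa [e]

/-- The expansion is needed only near `0`: it must agree with the Cauchy power series on the circle,
because a power series at a point is unique. -/
theorem circleIntegral_eq_coeff {c : ℕ → ℂ} {h : ℂ → ℂ} {ρ : ℝ} (hρ : 0 < ρ)
    (hd : DifferentiableOn ℂ h (Metric.closedBall 0 ρ))
    (hs : ∀ᶠ z in 𝓝 0, HasSum (fun m => c m * z ^ m) (h z)) (m : ℕ) :
    1 / (2 * Real.pi * Complex.I) * ∮ z in C(0, ρ), h z * (1 / z ^ (m + 1)) = c m := by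
  have h1 : HasFPowerSeriesAt h (FormalMultilinearSeries.ofScalars ℂ c) 0 := by
    rw [hasFPowerSeriesAt_iff']
    filter_upwards [hs] with z hz
    simpa [FormalMultilinearSeries.coeff_ofScalars, mul_comm] using hz
  lift ρ to NNReal using hρ.le
  have h2 := (hd.hasFPowerSeriesOnBall (by exact_mod_cast hρ)).hasFPowerSeriesAt
  have h3 := congrArg (fun q => q.coeff m) (h1.eq_formalMultilinearSeries h2)
  simp only [FormalMultilinearSeries.coeff_ofScalars] at h3
  rw [h3, FormalMultilinearSeries.coeff, Pi.one_def, cauchyPowerSeries_apply, smul_eq_mul,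
    one_div]
  congr 1
  refine congrArg (fun f => circleIntegral f 0 ρ) (funext fun z => ?_)
  simp [pow_succ]
  ring

/-! ### The group differential system -/

/-- A bound for the growth of the vectors `A_p`. -/
def HasGrowth (n : ℕ) (k : ℂ) (x y : Plane) (R : ℝ) : Prop :=
  maxPairing n x y ≤ R ∧ ∃ M : ℝ, ∀ (p : ℕ) (j : Fin 2), ‖coeffA n k x y p j‖ ≤ M * R ^ p

section Growth

variable {n : ℕ} {k : ℂ} {x y : Plane} {R : ℝ} {z : ℂ}

theorem HasGrowth.nonneg (hn : n ≠ 0) (h : HasGrowth n k x y R) : 0 ≤ R :=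
  (maxPairing_nonneg hn x y).trans h.1

theorem HasGrowth.summable_norm (hn : n ≠ 0) (h : HasGrowth n k x y R) (hz : z ∈ disc R)
    (j : Fin 2) : Summable fun i => ‖coeffA n k x y i j * z ^ i‖ := by
  obtain ⟨M, hM⟩ := h.2
  have hR := h.nonneg hn
  refine Summable.of_nonneg_of_le (fun _ => norm_nonneg _) (fun i => ?_)
    ((summable_geometric_of_lt_one (mul_nonneg hR (norm_nonneg z)) hz).mul_left M)
  rw [norm_mul, norm_pow, mul_pow, ← mul_assoc]
  exact mul_le_mul_of_nonneg_right (hM i j) (by positivity)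

theorem HasGrowth.norm_mul_lt (h : HasGrowth n k x y R) (hz : z ∈ disc R)
    {t : ℝ} (ht : |t| ≤ maxPairing n x y) : ‖z * (t : ℂ)‖ < 1 := by
  rw [norm_mul, Complex.norm_real, mul_comm]
  exact (mul_le_mul_of_nonneg_right (ht.trans h.1) (norm_nonneg z)).trans_lt hz

theorem HasGrowth.summable_solQ (hn : n ≠ 0) (h : HasGrowth n k x y R) (hz : z ∈ disc R) :
    Summable fun p : ℕ => z ^ (p + 1) • coeffA n k x y (p + 1) := by
  rw [Pi.summable]
  intro j
  have := (summable_nat_add_iff 1).2 (h.summable_norm hn hz j).of_norm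
  simpa [mul_comm] using this

theorem HasGrowth.tsum_eq (hn : n ≠ 0) (h : HasGrowth n k x y R) (hz : z ∈ disc R) (j : Fin 2) :
    ∑' i, coeffA n k x y i j * z ^ i = coeffA n k x y 0 j + solQ n k x y z j := by
  rw [(h.summable_norm hn hz j).of_norm.tsum_eq_zero_add, solQ, tsum_apply (h.summable_solQ hn hz)]
  simp [mul_comm]

theorem HasGrowth.hasSum_sub (hn : n ≠ 0) (h : HasGrowth n k x y R) (hz : z ∈ disc R) {t : ℝ}
    (ht : |t| ≤ maxPairing n x y) :
    HasSum (fun p => z ^ p * ∑ i ∈ Finset.range (p + 1), (t : ℂ) ^ (p - i) *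
        (coeffA n k x y i 0 - coeffA n k x y i 1))
      ((2 * n / gam n k + solQ n k x y z 0 - solQ n k x y z 1) / (1 - z * t)) := by
  have s0 := h.summable_norm hn hz 0
  have s1 := h.summable_norm hn hz 1
  have := hasSum_geometric_mul (s := fun i => coeffA n k x y i 0 - coeffA n k x y i 1) (z := z)
    (t := t) (by
      refine Summable.of_nonneg_of_le (fun _ => norm_nonneg _) (fun i => ?_) (s0.add s1)
      rw [sub_mul]
      exact norm_sub_le _ _) (h.norm_mul_lt hz ht)
  simp only [sub_mul] at this
  rw [s0.of_norm.tsum_sub s1.of_norm, h.tsum_eq hn hz, h.tsum_eq hn hz, coeffA_zero] at this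
  simpa [sub_mul] using this

theorem HasGrowth.hasSum_add (hn : n ≠ 0) (h : HasGrowth n k x y R) (hz : z ∈ disc R) {t : ℝ}
    (ht : |t| ≤ maxPairing n x y) :
    HasSum (fun p => z ^ p * ∑ i ∈ Finset.range (p + 1), (t : ℂ) ^ (p - i) *
        (coeffA n k x y i 0 + coeffA n k x y i 1))
      ((2 * n / gam n k + solQ n k x y z 0 + solQ n k x y z 1) / (1 - z * t)) := by
  have s0 := h.summable_norm hn hz 0
  have s1 := h.summable_norm hn hz 1
  have := hasSum_geometric_mul (s := fun i => coeffA n k x y i 0 + coeffA n k x y i 1) (z := z)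
    (t := t) (by
      refine Summable.of_nonneg_of_le (fun _ => norm_nonneg _) (fun i => ?_) (s0.add s1)
      rw [add_mul]
      exact norm_add_le _ _) (h.norm_mul_lt hz ht)
  simp only [add_mul] at this
  rw [s0.of_norm.tsum_add s1.of_norm, h.tsum_eq hn hz, h.tsum_eq hn hz, coeffA_zero] at this
  simpa [add_mul] using this

/-- The function `u / (1 - zu)` generates `u ^ (q + 1)`, so `g` and `g_s` generate the entries of
the matrices `B_q`. -/
theorem hasSum_powerSum {u : ℕ → ℝ} {s : ℕ → ℂ} {S : ℂ}
    (h : ∀ j < n, HasSum (fun p => z ^ p * ∑ i ∈ Finset.range (p + 1), (u j : ℂ) ^ (p - i) * s i)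
      (S / (1 - z * u j))) :
    HasSum (fun p => z ^ p * ∑ i ∈ Finset.range (p + 1),
        (∑ j ∈ Finset.range n, (u j : ℂ) ^ (p - i + 1)) * s i)
      ((∑ j ∈ Finset.range n, (u j : ℂ) / (1 - z * u j)) * S) := by
  have h' := hasSum_sum fun j (hj : j ∈ Finset.range n) =>
    (h j (Finset.mem_range.1 hj)).mul_left (u j : ℂ)
  have e1 : (fun p => z ^ p * ∑ i ∈ Finset.range (p + 1),
      (∑ j ∈ Finset.range n, (u j : ℂ) ^ (p - i + 1)) * s i) = fun p => ∑ j ∈ Finset.range n,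
      (u j : ℂ) * (z ^ p * ∑ i ∈ Finset.range (p + 1), (u j : ℂ) ^ (p - i) * s i) := by
    funext p
    simp only [Finset.sum_mul, Finset.mul_sum]
    rw [Finset.sum_comm]
    exact Finset.sum_congr rfl fun j _ => Finset.sum_congr rfl fun i _ => by ring
  have e2 : (∑ j ∈ Finset.range n, (u j : ℂ) / (1 - z * u j)) * S =
      ∑ j ∈ Finset.range n, (u j : ℂ) * (S / (1 - z * u j)) := by
    rw [Finset.sum_mul]
    exact Finset.sum_congr rfl fun j _ => by ring
  rwa [e1, e2]

theorem HasGrowth.hasSum_rotPow (hn : n ≠ 0) (h : HasGrowth n k x y R) (hz : z ∈ disc R) :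
    HasSum (fun p => z ^ p * ∑ i ∈ Finset.range (p + 1), rotPow n x y (p - i + 1) *
        (coeffA n k x y i 0 - coeffA n k x y i 1))
      ((∑ j ∈ Finset.range n, ((inner ℝ (rot n j x) y : ℝ) : ℂ) /
        (1 - z * ((inner ℝ (rot n j x) y : ℝ) : ℂ))) *
        (2 * n / gam n k + solQ n k x y z 0 - solQ n k x y z 1)) :=
  hasSum_powerSum (u := fun j => inner ℝ (rot n j x) y) fun _ hj =>
    h.hasSum_sub hn hz (abs_inner_rot_le_maxPairing hj x y).1

theorem HasGrowth.hasSum_reflPow (hn : n ≠ 0) (h : HasGrowth n k x y R) (hz : z ∈ disc R) :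
    HasSum (fun p => z ^ p * ∑ i ∈ Finset.range (p + 1), reflPow n x y (p - i + 1) *
        (coeffA n k x y i 0 + coeffA n k x y i 1))
      ((∑ j ∈ Finset.range n, ((inner ℝ (rot n j (sigma x)) y : ℝ) : ℂ) /
        (1 - z * ((inner ℝ (rot n j (sigma x)) y : ℝ) : ℂ))) *
        (2 * n / gam n k + solQ n k x y z 0 + solQ n k x y z 1)) :=
  hasSum_powerSum (u := fun j => inner ℝ (rot n j (sigma x)) y) fun _ hj =>
    h.hasSum_add hn hz (abs_inner_rot_le_maxPairing hj x y).2

theorem isOpen_disc (R : ℝ) : IsOpen (disc R) :=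
  isOpen_lt (continuous_const.mul continuous_norm) continuous_const

theorem convex_disc (hR : 0 ≤ R) : Convex ℝ (disc R) := by
  have := ((convexOn_norm (E := ℂ) convex_univ).smul hR).convex_lt 1
  simpa [disc] using this

theorem zero_mem_disc (R : ℝ) : (0 : ℂ) ∈ disc R := by simp [disc]

theorem HasGrowth.hasDerivAt_solQ (hn : n ≠ 0) (h : HasGrowth n k x y R) (hz : z ∈ disc R) :
    ∃ X' : Fin 2 → ℂ, HasDerivAt (solQ n k x y) X' z ∧
      ∀ j, HasSum (fun p : ℕ => ((p : ℂ) + 1) * z ^ p * coeffA n k x y (p + 1) j) (X' j) := by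
  have hR := h.nonneg hn
  obtain ⟨M, hM⟩ := h.2
  have hM0 : 0 ≤ M := by simpa using (norm_nonneg _).trans (hM 0 0)
  -- A slightly larger radius still inside the disc gives a uniform summable bound for the
  -- derivatives. The form `R * r < 1` includes `R = 0`.
  obtain ⟨r, hzr, hr⟩ : ∃ r, ‖z‖ < r ∧ R * r < 1 := by
    have hc : ContinuousAt (fun r : ℝ => R * r) ‖z‖ := by fun_prop
    have := (hc.eventually (gt_mem_nhds hz)).filter_mono (nhdsWithin_le_nhds (s := Set.Ioi ‖z‖))
    obtain ⟨r, hr1, hr2⟩ := (this.and self_mem_nhdsWithin).exists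
    exact ⟨r, hr2, hr1⟩
  have hr0 : 0 < r := (norm_nonneg z).trans_lt hzr
  have hq : ‖R * r‖ < 1 := by rwa [Real.norm_of_nonneg (by positivity)]
  have hu : Summable fun p : ℕ => ((p : ℝ) + 1) * (R * r) ^ p * (M * R) := by
    refine Summable.mul_right _ ?_
    simp only [add_mul, one_mul]
    have := summable_pow_mul_geometric_of_norm_lt_one 1 hq
    simp only [pow_one] at this
    exact this.add (summable_geometric_of_norm_lt_one hq)
  have hbound : ∀ (p : ℕ) (w : ℂ), w ∈ Metric.ball (0 : ℂ) r →
      ‖(((p : ℂ) + 1) * w ^ p) • coeffA n k x y (p + 1)‖ ≤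
        ((p : ℝ) + 1) * (R * r) ^ p * (M * R) := by
    intro p w hw
    have hp : ‖(p : ℂ) + 1‖ = p + 1 := by exact_mod_cast Complex.norm_natCast (p + 1)
    have hA : ‖coeffA n k x y (p + 1)‖ ≤ M * R ^ (p + 1) :=
      (pi_norm_le_iff_of_nonneg (by positivity)).2 (hM (p + 1))
    have hw' : ‖w‖ ≤ r := (mem_ball_zero_iff.1 hw).le
    rw [norm_smul, norm_mul, norm_pow, hp]
    calc _ ≤ ((p : ℝ) + 1) * r ^ p * (M * R ^ (p + 1)) := by gcongr
      _ = _ := by rw [mul_pow]; ring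
  have hzb : z ∈ Metric.ball (0 : ℂ) r := by simpa using hzr
  have hd := hasDerivAt_tsum_of_isPreconnected (𝕜 := ℂ) (t := Metric.ball (0 : ℂ) r) (y₀ := 0)
    (g := fun (p : ℕ) (w : ℂ) => w ^ (p + 1) • coeffA n k x y (p + 1))
    (g' := fun (p : ℕ) (w : ℂ) => (((p : ℂ) + 1) * w ^ p) • coeffA n k x y (p + 1)) hu
    Metric.isOpen_ball (convex_ball (0 : ℂ) r).isPreconnected
    (fun p w _ => by
      have := (hasDerivAt_pow (p + 1) w).smul_const (coeffA n k x y (p + 1))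
      simpa using this)
    hbound (Metric.mem_ball_self hr0) (h.summable_solQ hn (zero_mem_disc R)) hzb
  refine ⟨_, hd, fun j => ?_⟩
  have hs : Summable fun p : ℕ => (((p : ℂ) + 1) * z ^ p) • coeffA n k x y (p + 1) :=
    Summable.of_norm_bounded hu fun p => hbound p z hzb
  exact Pi.hasSum.1 hs.hasSum j

theorem HasGrowth.hasDerivAt_system (hn : n ≠ 0) (hk : ∀ m : ℕ, gam n k ≠ -(m : ℂ) / 2)
    (h : HasGrowth n k x y R) (hz : z ∈ disc R) (hz0 : z ≠ 0) :
    HasDerivAt (solQ n k x y) (![gFun n x y z, gsFun n x y z] +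
      (sysMatrix n k x y z).mulVec (solQ n k x y z)) z := by
  have hn' : (n : ℂ) ≠ 0 := Nat.cast_ne_zero.2 hn
  have hg : gam n k ≠ 0 := by simpa using hk 0
  obtain ⟨X', hX', hsum⟩ := h.hasDerivAt_solQ hn hz
  have hr := h.hasSum_rotPow hn hz
  have hs := h.hasSum_reflPow hn hz
  set GU := ∑ j ∈ Finset.range n, ((inner ℝ (rot n j x) y : ℝ) : ℂ) /
    (1 - z * ((inner ℝ (rot n j x) y : ℝ) : ℂ)) with hGU
  set GV := ∑ j ∈ Finset.range n, ((inner ℝ (rot n j (sigma x)) y : ℝ) : ℂ) /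
    (1 - z * ((inner ℝ (rot n j (sigma x)) y : ℝ) : ℂ)) with hGV
  have hgF : gFun n x y z = GU + GV := rfl
  have hgsF : gsFun n x y z = GU - GV := rfl
  have e0 : X' 0 = gam n k / (2 * n) *
      (GU * (2 * n / gam n k + solQ n k x y z 0 - solQ n k x y z 1) +
        GV * (2 * n / gam n k + solQ n k x y z 0 + solQ n k x y z 1)) := by
    refine (hsum 0).unique ?_
    refine ((hr.add hs).mul_left (gam n k / (2 * n))).congr_terms fun p => ?_
    have hp : (p : ℂ) + 1 ≠ 0 := Nat.cast_add_one_ne_zero p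
    rw [coeffA_succ_zero, Finset.sum_add_distrib]
    field_simp
  have hQ : HasSum (fun p => z ^ p * coeffA n k x y (p + 1) 1) (z⁻¹ * solQ n k x y z 1) := by
    refine ((Pi.hasSum.1 (h.summable_solQ hn hz).hasSum 1).mul_left z⁻¹).congr_terms fun p => ?_
    simp only [Pi.smul_apply, smul_eq_mul, pow_succ]
    field_simp
  -- The recursion for the second component is cleared of `p + 1 + 2γ`: the part `p + 1` sums to the
  -- derivative and the part `2γ` to the singular term `2γ Q₂ / z`. The inhomogeneous term of the
  -- system comes from `A₀`.
  have e1 : X' 1 + 2 * gam n k * (z⁻¹ * solQ n k x y z 1) = gam n k / (2 * n) *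
      (GU * (2 * n / gam n k + solQ n k x y z 0 - solQ n k x y z 1) -
        GV * (2 * n / gam n k + solQ n k x y z 0 + solQ n k x y z 1)) := by
    refine ((hsum 1).add (hQ.mul_left (2 * gam n k))).unique ?_
    refine ((hr.sub hs).mul_left (gam n k / (2 * n))).congr_terms fun p => ?_
    have hp : (p : ℂ) + 1 + 2 * gam n k ≠ 0 := by
      intro h
      refine hk (p + 1) ?_
      push_cast
      linear_combination h / 2
    rw [coeffA_succ_one, Finset.sum_sub_distrib]
    field_simp
  convert hX' using 1
  funext j
  fin_cases j
  · simp only [Fin.zero_eta, Pi.add_apply, sysMatrix, Matrix.mulVec, dotProduct, Fin.sum_univ_two,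
      Matrix.of_apply, Matrix.cons_val', Matrix.cons_val_zero, Matrix.cons_val_one,
      Matrix.cons_val_fin_one, hgF, hgsF, e0]
    field_simp
    ring
  · simp only [Fin.mk_one, Pi.add_apply, sysMatrix, Matrix.mulVec, dotProduct, Fin.sum_univ_two,
      Matrix.of_apply, Matrix.cons_val', Matrix.cons_val_zero, Matrix.cons_val_one,
      Matrix.cons_val_fin_one, hgF, hgsF, eq_sub_of_add_eq e1]
    field_simp
    ring

theorem HasGrowth.isVanishingSolution (hn : n ≠ 0) (hk : ∀ m : ℕ, gam n k ≠ -(m : ℂ) / 2)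
    (h : HasGrowth n k x y R) : IsVanishingSolution n k x y (disc R) (solQ n k x y) where
  holomorphic _ hz := by
    obtain ⟨X', hX', -⟩ := h.hasDerivAt_solQ hn hz
    exact hX'.differentiableAt.differentiableWithinAt
  vanishes := by simp [solQ]
  solves _ hz hz0 := h.hasDerivAt_system hn hk hz hz0

end Growth

/-! ### Uniqueness of the solution -/

theorem continuousAt_sum_div (n : ℕ) (u : ℕ → ℂ) :
    ContinuousAt (fun z : ℂ => ∑ i ∈ Finset.range n, u i / (1 - z * u i)) 0 := by
  refine tendsto_finsetSum _ fun i _ => ?_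
  have : ContinuousAt (fun z : ℂ => u i / (1 - z * u i)) 0 :=
    ContinuousAt.div (by fun_prop) (by fun_prop) (by simp)
  exact this

theorem continuousAt_gFun (n : ℕ) (x y : Plane) : ContinuousAt (gFun n x y) 0 :=
  (continuousAt_sum_div n _).add (continuousAt_sum_div n _)

theorem continuousAt_gsFun (n : ℕ) (x y : Plane) : ContinuousAt (gsFun n x y) 0 :=
  (continuousAt_sum_div n _).sub (continuousAt_sum_div n _)

theorem eq_zero_of_tendsto_of_eventually {L : ℂ → ℂ} (hc : ContinuousAt L 0)
    (h : ∀ᶠ z in 𝓝[≠] 0, L z = 0) : L 0 = 0 :=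
  tendsto_nhds_unique (hc.tendsto.mono_left nhdsWithin_le_nhds)
    (tendsto_const_nhds.congr' (h.mono fun _ hz => hz.symm))

/-- An analytic solution of the homogeneous system that vanishes at `0` vanishes near `0`. -/
theorem eventually_eq_zero_of_hasDerivAt {n : ℕ} {k : ℂ}
    (hk : ∀ m : ℕ, gam n k ≠ -(m : ℂ) / 2) {x y : Plane} {D : ℂ → Fin 2 → ℂ}
    (hD : AnalyticAt ℂ D 0) (h0 : D 0 = 0)
    (h : ∀ᶠ z in 𝓝[≠] 0, HasDerivAt D ((sysMatrix n k x y z).mulVec (D z)) z) :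
    ∀ᶠ z in 𝓝 0, D z = 0 := by
  by_contra hne
  -- Factor out the order of vanishing, `D = z ^ p • d` with `d 0 ≠ 0`; `p = 0` is excluded by `D 0
  -- = 0`.
  obtain ⟨p, d, hd, hd0, heq⟩ := hD.exists_eventuallyEq_pow_smul_nonzero_iff.2 hne
  simp only [sub_zero] at heq
  obtain _ | q := p
  · have := heq.self_of_nhds
    rw [h0, pow_zero, one_smul] at this
    exact hd0 this.symm
  have hdj : ∀ j, ContinuousAt (fun z => d z j) 0 := fun j =>
    (continuousAt_pi.1 hd.continuousAt) j
  have hd'j : ∀ j, ContinuousAt (fun z => deriv d z j) 0 := fun j =>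
    (continuousAt_pi.1 hd.deriv.continuousAt) j
  have hg := continuousAt_gFun n x y
  have hgs := continuousAt_gsFun n x y
  have key : ∀ᶠ z in 𝓝[≠] (0 : ℂ), ∀ j, z * (((q : ℂ) + 1) * d z j + z * deriv d z j) =
      z * (z * (sysMatrix n k x y z).mulVec (d z) j) := by
    filter_upwards [h, heq.eventually_nhds.filter_mono nhdsWithin_le_nhds,
      hd.eventually_analyticAt.filter_mono nhdsWithin_le_nhds, self_mem_nhdsWithin]
      with z hz hez hdz hz0
    have hz0' : z ≠ 0 := hz0
    have h1 : HasDerivAt (fun z => z ^ (q + 1) • d z) _ z :=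
      (hasDerivAt_pow (q + 1) z).smul hdz.differentiableAt.hasDerivAt
    have h2 := h1.unique (hz.congr_of_eventuallyEq (hez.mono fun _ hw => hw.symm))
    intro j
    have h3 := congrFun h2 j
    rw [hez.self_of_nhds, Matrix.mulVec_smul] at h3
    simp only [Pi.add_apply, Pi.smul_apply, smul_eq_mul, Nat.add_sub_cancel] at h3
    push_cast at h3
    have hzq : z ^ q ≠ 0 := pow_ne_zero q hz0'
    apply mul_left_cancel₀ hzq
    linear_combination z * h3
  -- As `z → 0`, `z` times the system matrix tends to `diag(0, -2γ)`, so the equation degenerates to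
  -- `(q + 1) d₀ = 0` and `(q + 1 + 2γ) d₁ = 0` at `0`.
  have k0 : ((q : ℂ) + 1) * d 0 0 = 0 := by
    have := eq_zero_of_tendsto_of_eventually (L := fun z => ((q : ℂ) + 1) * d z 0 +
      z * deriv d z 0 - z * (gam n k / (2 * n) * gFun n x y z * d z 0 -
        gam n k / (2 * n) * gsFun n x y z * d z 1)) (by
          have := hdj 0; have := hdj 1; have := hd'j 0
          fun_prop) (by
      filter_upwards [key, self_mem_nhdsWithin] with z hz hz0
      have hz' := mul_left_cancel₀ hz0 (hz 0)
      simp only [sysMatrix, Matrix.mulVec, dotProduct, Fin.sum_univ_two,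
        Matrix.of_apply, Matrix.cons_val', Matrix.cons_val_zero, Matrix.cons_val_one,
        Matrix.cons_val_fin_one] at hz'
      linear_combination hz')
    simpa using this
  have k1 : ((q : ℂ) + 1 + 2 * gam n k) * d 0 1 = 0 := by
    have := eq_zero_of_tendsto_of_eventually (L := fun z => ((q : ℂ) + 1 + 2 * gam n k) * d z 1 +
      z * deriv d z 1 - z * (gam n k / (2 * n) * gsFun n x y z * d z 0 -
        gam n k / (2 * n) * gFun n x y z * d z 1)) (by
          have := hdj 0; have := hdj 1; have := hd'j 1
          fun_prop) (by
      filter_upwards [key, self_mem_nhdsWithin] with z hz hz0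
      have hz0' : z ≠ 0 := hz0
      have hz' := mul_left_cancel₀ hz0 (hz 1)
      simp only [sysMatrix, Matrix.mulVec, dotProduct, Fin.sum_univ_two,
        Matrix.of_apply, Matrix.cons_val', Matrix.cons_val_zero, Matrix.cons_val_one,
        Matrix.cons_val_fin_one] at hz'
      have e : z * (2 * gam n k / z) = 2 * gam n k := by field_simp
      linear_combination hz' - d z 1 * e)
    simpa using this
  refine hd0 (funext fun j => ?_)
  fin_cases j
  · exact (mul_eq_zero.1 k0).resolve_left (Nat.cast_add_one_ne_zero q)
  · refine (mul_eq_zero.1 k1).resolve_left fun hq => hk (q + 1) ?_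
    push_cast
    linear_combination hq / 2

/-- The difference solves the homogeneous system, hence vanishes near `0`; the identity theorem
extends this to the connected overlap. -/
theorem IsVanishingSolution.eqOn {n : ℕ} {k : ℂ} (hk : ∀ m : ℕ, gam n k ≠ -(m : ℂ) / 2)
    {x y : Plane} {U₁ U₂ : Set ℂ} {X₁ X₂ : ℂ → Fin 2 → ℂ}
    (h₁ : IsVanishingSolution n k x y U₁ X₁) (h₂ : IsVanishingSolution n k x y U₂ X₂)
    (ho : IsOpen (U₁ ∩ U₂)) (hc : IsPreconnected (U₁ ∩ U₂)) (h0 : (0 : ℂ) ∈ U₁ ∩ U₂) :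
    Set.EqOn X₁ X₂ (U₁ ∩ U₂) := by
  have hD : AnalyticOnNhd ℂ (X₁ - X₂) (U₁ ∩ U₂) :=
    ((h₁.holomorphic.mono Set.inter_subset_left).sub
      (h₂.holomorphic.mono Set.inter_subset_right)).analyticOnNhd ho
  have hnear := eventually_eq_zero_of_hasDerivAt hk (x := x) (y := y) (hD 0 h0)
    (by simp [h₁.vanishes, h₂.vanishes]) (by
      filter_upwards [(ho.mem_nhds h0 : U₁ ∩ U₂ ∈ 𝓝 (0 : ℂ)) |> mem_nhdsWithin_of_mem_nhds,
        self_mem_nhdsWithin] with z hz hz0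
      have h := (h₁.solves z hz.1 hz0).sub (h₂.solves z hz.2 hz0)
      rwa [add_sub_add_left_eq_sub, ← Matrix.mulVec_sub] at h)
  intro z hz
  exact sub_eq_zero.1 (hD.eqOn_zero_of_preconnected_of_eventuallyEq_zero hc h0 hnear hz)

/-! ### The integral formula and the generating series -/

theorem abs_inner_le_maxPairing {n : ℕ} (hn : n ≠ 0) (x y : Plane) :
    |inner ℝ x y| ≤ maxPairing n x y := by
  have := (abs_inner_rot_le_maxPairing (Nat.pos_of_ne_zero hn) x y).1
  rwa [rot_zero] at this

section Growth

variable {n : ℕ} {k : ℂ} {x y : Plane} {R : ℝ}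

theorem HasGrowth.hasSum_dunklE (hn : n ≠ 0) (hk : ∀ m : ℕ, gam n k ≠ -(m : ℂ) / 2)
    (h : HasGrowth n k x y R) {z : ℂ} (hz : z ∈ disc R) :
    HasSum (fun m : ℕ => 2 * n / gam n k *
        (poch (1 + gam n k) m * dunklE n k m x y * z ^ m))
      (Phi n k z x y / (1 - z * ((inner ℝ x y : ℝ) : ℂ))) := by
  refine (h.hasSum_sub hn hz (abs_inner_le_maxPairing hn x y)).congr_terms fun m => ?_
  rw [← poch_mul_dunklE_eq hn hk]
  ring

theorem HasGrowth.dunklE_eq_circleIntegral (hn : n ≠ 0) (hk : ∀ m : ℕ, gam n k ≠ -(m : ℂ) / 2)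
    (h : HasGrowth n k x y R) {ρ : ℝ} (hρ : 0 < ρ) (hR : R * ρ < 1) (m : ℕ) :
    dunklE n k m x y = gam n k / (2 * n) / poch (1 + gam n k) m *
      (1 / (2 * Real.pi * Complex.I) *
        ∮ z in C(0, ρ), Phi n k z x y / (1 - z * ((inner ℝ x y : ℝ) : ℂ)) *
          (1 / z ^ (m + 1))) := by
  have hn' : (n : ℂ) ≠ 0 := Nat.cast_ne_zero.2 hn
  have hg : gam n k ≠ 0 := by simpa using hk 0
  have hp := poch_one_add_gam_ne_zero hk m
  have hsub : Metric.closedBall (0 : ℂ) ρ ⊆ disc R := fun z hz =>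
    (mul_le_mul_of_nonneg_left (mem_closedBall_zero_iff.1 hz) (h.nonneg hn)).trans_lt hR
  rw [circleIntegral_eq_coeff (c := fun m => 2 * n / gam n k *
    (poch (1 + gam n k) m * dunklE n k m x y)) hρ]
  · field_simp
  · intro z hz
    have hz' := hsub hz
    have hQ : DifferentiableAt ℂ (solQ n k x y) z := by
      obtain ⟨X', hX', -⟩ := h.hasDerivAt_solQ hn hz'
      exact hX'.differentiableAt
    have hQj := differentiableAt_pi.1 hQ
    have hne : 1 - z * ((inner ℝ x y : ℝ) : ℂ) ≠ 0 := by
      intro h1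
      have h2 := h.norm_mul_lt hz' (abs_inner_le_maxPairing hn x y)
      rw [← sub_eq_zero.1 h1, norm_one] at h2
      exact lt_irrefl _ h2
    have hnum : DifferentiableAt ℂ (fun z => Phi n k z x y) z :=
      ((hQj 0).const_add _).sub (hQj 1)
    have hden : DifferentiableAt ℂ (fun z : ℂ => 1 - z * ((inner ℝ x y : ℝ) : ℂ)) z := by fun_prop
    exact (hnum.fun_div hden hne).differentiableWithinAt
  · filter_upwards [(isOpen_disc R).mem_nhds (zero_mem_disc R)] with z hz
    exact (h.hasSum_dunklE hn hk hz).congr_terms fun m => by ring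

end Growth

end Analysis

end

end DihedralDunkl

theorem mainTheorem1 (n : ℕ) (hn : 2 ≤ n) (k : ℂ)
    (hk : ∀ m : ℕ, DihedralDunkl.gam n k ≠ -(m : ℂ) / 2) :
    -- the intertwining operator, through which the `E_m` are defined, exists and is unique
    (∃! V : DihedralDunkl.Poly ≃ₗ[ℂ] DihedralDunkl.Poly, DihedralDunkl.IsIntertwining n k V) ∧
    ∃ δ : ℝ, 1 ≤ δ ∧ ∀ x y : DihedralDunkl.Plane,
      -- the series defining `Q` converges, and `Q` is the holomorphic solution vanishing at `0`
      (∀ z ∈ DihedralDunkl.disc (δ * DihedralDunkl.maxPairing n x y),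
        Summable fun p : ℕ => z ^ (p + 1) • DihedralDunkl.coeffA n k x y (p + 1)) ∧
      DihedralDunkl.IsVanishingSolution n k x y
        (DihedralDunkl.disc (δ * DihedralDunkl.maxPairing n x y)) (DihedralDunkl.solQ n k x y) ∧
      (∀ r : ℝ, 0 < r → ∀ X : ℂ → Fin 2 → ℂ,
        DihedralDunkl.IsVanishingSolution n k x y (Metric.ball 0 r) X →
        Set.EqOn X (DihedralDunkl.solQ n k x y)
          (Metric.ball 0 r ∩ DihedralDunkl.disc (δ * DihedralDunkl.maxPairing n x y))) ∧
      -- the integral formula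
      (∀ ρ : ℝ, 0 < ρ → δ * DihedralDunkl.maxPairing n x y * ρ < 1 → ∀ m : ℕ,
        DihedralDunkl.dunklE n k m x y =
          DihedralDunkl.gam n k / (2 * n) / DihedralDunkl.poch (1 + DihedralDunkl.gam n k) m *
            (1 / (2 * Real.pi * Complex.I) *
              ∮ z in C(0, ρ), DihedralDunkl.Phi n k z x y / (1 - z * (inner ℝ x y : ℂ)) *
                (1 / z ^ (m + 1)))) ∧
      -- the generating series
      (∀ z ∈ DihedralDunkl.disc (δ * DihedralDunkl.maxPairing n x y),
        HasSum
          (fun m : ℕ => 2 * n / DihedralDunkl.gam n k *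
            (DihedralDunkl.poch (1 + DihedralDunkl.gam n k) m *
              DihedralDunkl.dunklE n k m x y * z ^ m))
          (DihedralDunkl.Phi n k z x y / (1 - z * (inner ℝ x y : ℂ)))) := by
  have hn0 : n ≠ 0 := by omega
  refine ⟨DihedralDunkl.existsUnique_isIntertwining hn0
    (DihedralDunkl.isRegularParam_of_gam_ne hk), ?_⟩
  obtain ⟨δ, hδ, hbound⟩ := DihedralDunkl.exists_growth_bound hn0 k
  refine ⟨δ, hδ, fun x y => ?_⟩
  -- Here `δ ≥ 1` keeps the poles `1 / ⟨g x, y⟩` of the coefficients outside the disc.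
  have h : DihedralDunkl.HasGrowth n k x y (δ * DihedralDunkl.maxPairing n x y) :=
    ⟨le_mul_of_one_le_left (DihedralDunkl.maxPairing_nonneg hn0 x y) hδ, _, hbound x y⟩
  refine ⟨fun z hz => h.summable_solQ hn0 hz, h.isVanishingSolution hn0 hk, fun r hr X hX => ?_,
    fun ρ hρ hR m => h.dunklE_eq_circleIntegral hn0 hk hρ hR m,
    fun z hz => h.hasSum_dunklE hn0 hk hz⟩
  exact hX.eqOn hk (h.isVanishingSolution hn0 hk)
    (Metric.isOpen_ball.inter (DihedralDunkl.isOpen_disc _))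
    ((convex_ball (0 : ℂ) r).inter (DihedralDunkl.convex_disc (h.nonneg hn0))).isPreconnected
    ⟨Metric.mem_ball_self hr, DihedralDunkl.zero_mem_disc _⟩
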